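/- **Setup.** There are $K$ data streams. Stream $a\in[K]=\{1,\dots,K\}$ has a pre-change density $f_{a,0}$ and a post-change density $f_{a,1}$ with respect to a common dominating measure $\lambda$; $f_{a,0}$ and $f_{a,1}$ vanish at the same points, up to a $\lambda$-null set, so that log-likelihood ratios are finite. The observations $X_{a,n}$ ($a\in[K]$, $n\ge 1$) are mutually independent. For a change-point $\nu\in\mathbb N=\{1,2,\dots\}$ and a set $\mathcal A\subseteq[K]$ of affected streams, $X_{a,n}$ has density $f_{a,1}$ under $\mathbb P_{\nu,\mathcal A}$ if $n\ge\nu$ and $a\in\mathcal A$, and density $f_{a,0}$ otherwise; under $\mathbb P_\infty$ all $X_{a,n}$ have density $f_{a,0}$. Write $\mathrm{LLR}(a,x)=\log\big(f_{a,1}(x)/f_{a,0}(x)\big)$ and $D(f_{a,1}\|f_{a,0})=\int \log(f_{a,1}/f_{a,0})\,f_{a,1}\,d\lambda$. Assume that for every $a\in[K]$, $D(f_{a,1}\|f_{a,0})>0$ and, for a known constant $v<\infty$, $$\log\int \exp\!\Big(\theta\big(\log (f_{a,1}/f_{a,0})-D(f_{a,1}\|f_{a,0})\big)\Big)f_{a,1}\,d\lambda\le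 \frac v2\theta^2\qquad\text{for all }\theta\in\mathbb R .$$ **Procedure.** At each time-step $n\ge1$ one action $A_n\in[K]$ is chosen and $X_{A_n,n}$ is observed; let $\mathcal F_n=\sigma(X_{A_1,1},\dots,X_{A_n,n})$. Fix an interval length $W\ge1$ and let $m(n)=(\lceil n/W\rceil-1)W+1$ be the first time-step of the length-$W$ interval that contains $n$. Let $N_a$ be the number of $i\in\{m(n),\dots,n-1\}$ with $A_i=a$, and let $\hat\mu_a$ be the average of $\mathrm{LLR}(a,X_{a,i})$ over these $i$. The UCB policy $A_{\mathrm{UCB}}$ chooses $$A_n\in\operatorname*{argmax}_{a\in[K]}\Big(\hat\mu_a+\sqrt{4v\log W/N_a}\Big),$$ where the index is $+\infty$ if $N_a=0$ and ties are broken by a fixed rule, which depends only on the set of maximizers. Let $C_0=0$, $C_n=\max\{C_{n-1},0\}+\mathrm{LLR}(A_n,X_{A_n,n})$, and $T_b=\inf\{n\ge1: C_n\ge b\}$. Lorden's worst-case delay is $$\mathcal J_{\mathcal A}(A,T)=\sup_{\nu\ge1}\operatorname{ess\,sup}\ \mathbb E_{\nu,\mathcal A}\big[(T-\nu+1)^+\,\big|\,\mathcal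 F_{\nu-1}\big].$$ **Theorem.** Let $b=\log\gamma$. 1. For all $\gamma>0$ and all $W\ge1$, $\mathbb E_\infty[T_b]\ge\gamma$. 2. For every nonempty $\mathcal A\subseteq[K]$, as $\gamma,W\to\infty$ with $W=o(\log\gamma)$, $$\mathcal J_{\mathcal A}(A_{\mathrm{UCB}},T_b)\le\frac{\log\gamma}{I_{\mathcal A}}\,(1+o(1)),\qquad I_{\mathcal A}=\max_{a\in\mathcal A}D(f_{a,1}\|f_{a,0}).$$ -/

import Mathlib

open MeasureTheory ProbabilityTheory Filter Topology
open scoped ENNReal NNReal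

noncomputable section

namespace BanditQCD

/-- `K` data streams with values in `𝓧`, each with a pre-change density `pre a` and a post-change
density `post a` with respect to a common dominating measure `base`. -/
structure Channels (K : ℕ) (𝓧 : Type*) [MeasurableSpace 𝓧] where
  base : Measure 𝓧
  pre : Fin K → 𝓧 → ℝ
  post : Fin K → 𝓧 → ℝ
  measurable_pre : ∀ a, Measurable (pre a)
  measurable_post : ∀ a, Measurable (post a)
  pre_nonneg : ∀ a x, 0 ≤ pre a x
  post_nonneg : ∀ a x, 0 ≤ post a x
  lintegral_pre : ∀ a, ∫⁻ x, ENNReal.ofReal (pre a x) ∂base = 1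
  lintegral_post : ∀ a, ∫⁻ x, ENNReal.ofReal (post a x) ∂base = 1

/-- The sample space of all observations: `ω (n, a)` is the observation `X_{a,n}` of stream `a` at
time-step `n`. Time-steps are `n = 1, 2, …`; the coordinates with `n = 0` are never used. -/
abbrev Observations (K : ℕ) (𝓧 : Type*) : Type _ := ℕ × Fin K → 𝓧

variable {K : ℕ} {𝓧 : Type*} [MeasurableSpace 𝓧]

namespace Channels

/-- The pre-change distribution of stream `a`. -/
def preMeasure (M : Channels K 𝓧) (a : Fin K) : Measure 𝓧 :=
  M.base.withDensity fun x => ENNReal.ofReal (M.pre a x)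

/-- The post-change distribution of stream `a`. -/
def postMeasure (M : Channels K 𝓧) (a : Fin K) : Measure 𝓧 :=
  M.base.withDensity fun x => ENNReal.ofReal (M.post a x)

instance (M : Channels K 𝓧) (a : Fin K) : IsProbabilityMeasure (M.preMeasure a) :=
  ⟨by simp [preMeasure, M.lintegral_pre a]⟩

instance (M : Channels K 𝓧) (a : Fin K) : IsProbabilityMeasure (M.postMeasure a) :=
  ⟨by simp [postMeasure, M.lintegral_post a]⟩

/-- The log-likelihood ratio `LLR(a, x)`. -/
def llr (M : Channels K 𝓧) (a : Fin K) (x : 𝓧) : ℝ :=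
  Real.log (M.post a x / M.pre a x)

lemma measurable_llr (M : Channels K 𝓧) (a : Fin K) : Measurable (M.llr a) :=
  Real.measurable_log.comp ((M.measurable_post a).div (M.measurable_pre a))

/-- The Kullback-Leibler divergence `D(f_{a,1} || f_{a,0})`. -/
def kl (M : Channels K 𝓧) (a : Fin K) : ℝ :=
  ∫ x, Real.log (M.post a x / M.pre a x) * M.post a x ∂M.base

/-- The largest divergence over a nonempty set of streams. -/
def maxKl (M : Channels K 𝓧) (𝒜 : Finset (Fin K)) (h𝒜 : 𝒜.Nonempty) : ℝ :=
  𝒜.sup' h𝒜 M.kl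

/-- The law of the observations when the streams in `𝒜` change at time-step `ν`: all observations
are independent, and `X_{a,n}` has the post-change law iff `n ≥ ν` and `a ∈ 𝒜`. -/
def law (M : Channels K 𝓧) (𝒜 : Finset (Fin K)) (ν : ℕ) : Measure (Observations K 𝓧) :=
  Measure.infinitePi fun p : ℕ × Fin K =>
    if ν ≤ p.1 ∧ p.2 ∈ 𝒜 then M.postMeasure p.2 else M.preMeasure p.2

/-- The law of the observations when no change occurs. -/
def lawNoChange (M : Channels K 𝓧) : Measure (Observations K 𝓧) :=
  Measure.infinitePi fun p : ℕ × Fin K => M.preMeasure p.2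

instance (M : Channels K 𝓧) (𝒜 : Finset (Fin K)) (ν : ℕ) : IsProbabilityMeasure (M.law 𝒜 ν) := by
  have h : ∀ p : ℕ × Fin K, IsProbabilityMeasure
      (if ν ≤ p.1 ∧ p.2 ∈ 𝒜 then M.postMeasure p.2 else M.preMeasure p.2) := by
    intro p
    split_ifs <;> infer_instance
  unfold law
  infer_instance

instance (M : Channels K 𝓧) : IsProbabilityMeasure M.lawNoChange := by
  unfold lawNoChange
  infer_instance

end Channels

/-- `ℱ_n = σ(X_{A_1,1}, …, X_{A_n,n})`, the information collected up to time-step `n` when the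
actions are `A_1, A_2, …`. -/
@[reducible] def history (A : ℕ → Observations K 𝓧 → Fin K) (n : ℕ) : MeasurableSpace (Observations K 𝓧) :=
  ⨆ i ∈ Finset.Icc 1 n, MeasurableSpace.comap (fun ω => ω (i, A i ω)) inferInstance

/-- A control policy: actions `A_1, A_2, …` such that `A_n` is `ℱ_{n-1}`-measurable.
(The value `act 0` is never used.) -/
structure ControlPolicy (K : ℕ) (𝓧 : Type*) [MeasurableSpace 𝓧] where
  act : ℕ → Observations K 𝓧 → Fin K
  adapted : ∀ n, 1 ≤ n → Measurable[history act (n - 1)] (act n)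

/-- The CuSum-like statistic `C_0 = 0`, `C_n = (C_{n-1})⁺ + LLR(A_n, X_{A_n,n})`. -/
def cusum (M : Channels K 𝓧) (A : ControlPolicy K 𝓧) : ℕ → Observations K 𝓧 → ℝ
  | 0, _ => 0
  | n + 1, ω => max (cusum M A n ω) 0 + M.llr (A.act (n + 1) ω) (ω (n + 1, A.act (n + 1) ω))

/-- The alarm time `T_b = inf {n ≥ 1 : C_n ≥ b}`, infinite if the threshold is never reached. -/
def alarmTime (M : Channels K 𝓧) (A : ControlPolicy K 𝓧) (b : ℝ) : Observations K 𝓧 → ℕ∞ :=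
  hittingAfter (cusum M A) (Set.Ici b) 1

/-- The mean time to false alarm `𝔼_∞[T]`. -/
def meanTimeToFalseAlarm (M : Channels K 𝓧) (T : Observations K 𝓧 → ℕ∞) : ℝ≥0∞ :=
  ∫⁻ ω, (T ω : ℝ≥0∞) ∂M.lawNoChange

/-- Lorden's worst-case delay `sup_{ν ≥ 1} ess sup 𝔼_ν[(T - ν + 1)⁺ | ℱ_{ν-1}]`. The positive part
is the truncated subtraction of `ℝ≥0∞`. -/
def worstCaseDelay (M : Channels K 𝓧) (𝒜 : Finset (Fin K)) (A : ControlPolicy K 𝓧)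
    (T : Observations K 𝓧 → ℕ∞) : ℝ≥0∞ :=
  ⨆ (ν : ℕ) (_ : 1 ≤ ν),
    essSup (condLExp (history A.act (ν - 1)) (M.law 𝒜 ν) fun ω => (T ω : ℝ≥0∞) + 1 - (ν : ℝ≥0∞))
      (M.law 𝒜 ν)

/-! ### The UCB rule with restarts every `W` time-steps

For time-step `n ≥ 1` the statistics below use the time-steps before `n` that lie in the same
interval `{(j - 1) W + 1, …, j W}` as `n`. Here `α i` is the action at time-step `i`. -/

/-- The first time-step of the interval that contains `n ≥ 1`. -/
def intervalStart (W n : ℕ) : ℕ := (n - 1) / W * W + 1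

/-- The number of times `a` has been selected in the current interval, before time-step `n`. -/
def pulls (W : ℕ) (α : ℕ → Fin K) (n : ℕ) (a : Fin K) : ℕ :=
  ∑ i ∈ Finset.Ico (intervalStart W n) n, if α i = a then 1 else 0

/-- The mean reward of `a` in the current interval, before time-step `n`
(equal to `0` if `a` has not been selected). -/
def meanReward (M : Channels K 𝓧) (W : ℕ) (ω : Observations K 𝓧) (α : ℕ → Fin K) (n : ℕ)
    (a : Fin K) : ℝ :=
  (∑ i ∈ Finset.Ico (intervalStart W n) n, if α i = a then M.llr (α i) (ω (i, α i)) else 0) /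
    (pulls W α n a : ℝ)

/-- The UCB index of `a` used for choosing the action at time-step `n`
(equal to `∞` if `a` has not been selected). -/
def ucbIndex (M : Channels K 𝓧) (v : ℝ≥0) (W : ℕ) (ω : Observations K 𝓧) (α : ℕ → Fin K) (n : ℕ)
    (a : Fin K) : EReal :=
  if pulls W α n a = 0 then ⊤
  else ((meanReward M W ω α n a + √(4 * (v : ℝ) * Real.log W / (pulls W α n a : ℝ)) : ℝ) : EReal)

open scoped Classical in
/-- The set of actions with the largest UCB index. -/
def ucbArgmax (M : Channels K 𝓧) (v : ℝ≥0) (W : ℕ) (ω : Observations K 𝓧) (α : ℕ → Fin K)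
    (n : ℕ) : Finset (Fin K) :=
  Finset.univ.filter fun a => ∀ a', ucbIndex M v W ω α n a' ≤ ucbIndex M v W ω α n a

/-- The UCB actions: at each time-step an action with the largest index, ties being broken
by the rule `tie`. The actions at time-steps `≥ n` do not enter the indices for time-step `n`. -/
def ucbAct (M : Channels K 𝓧) (v : ℝ≥0) (W : ℕ) (tie : Finset (Fin K) → Fin K)
    (n : ℕ) (ω : Observations K 𝓧) : Fin K :=
  tie (ucbArgmax M v W ω
    (fun i => if _h : i < n then ucbAct M v W tie i ω else tie Finset.univ) n)
termination_by n
decreasing_by exact _h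

lemma ucbArgmax_congr (M : Channels K 𝓧) (v : ℝ≥0) (W : ℕ) (ω : Observations K 𝓧)
    {α β : ℕ → Fin K} {n : ℕ} (h : ∀ i < n, α i = β i) :
    ucbArgmax M v W ω α n = ucbArgmax M v W ω β n := by
  have hp : ∀ a, pulls W α n a = pulls W β n a := fun a =>
    Finset.sum_congr rfl fun i hi => by rw [h i (Finset.mem_Ico.1 hi).2]
  have hm : ∀ a, meanReward M W ω α n a = meanReward M W ω β n a := by
    intro a
    unfold meanReward
    rw [hp a]
    congr 1
    exact Finset.sum_congr rfl fun i hi => by rw [h i (Finset.mem_Ico.1 hi).2]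
  have hi : ∀ a, ucbIndex M v W ω α n a = ucbIndex M v W ω β n a := by
    intro a
    unfold ucbIndex
    rw [hp a, hm a]
  unfold ucbArgmax
  simp only [hi]

/-- The action at time-step `n` maximizes the UCB index computed from the earlier actions. -/
lemma ucbAct_eq (M : Channels K 𝓧) (v : ℝ≥0) (W : ℕ) (tie : Finset (Fin K) → Fin K)
    (n : ℕ) (ω : Observations K 𝓧) :
    ucbAct M v W tie n ω = tie (ucbArgmax M v W ω (fun i => ucbAct M v W tie i ω) n) := by
  rw [ucbAct]
  congr 1
  refine ucbArgmax_congr M v W ω fun i hi => ?_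
  simp [hi]

lemma history_mono (A : ℕ → Observations K 𝓧 → Fin K) {m n : ℕ} (h : m ≤ n) :
    history A m ≤ history A n :=
  biSup_mono fun _ hi => Finset.Icc_subset_Icc_right h hi

lemma measurable_obs (A : ℕ → Observations K 𝓧 → Fin K) {i n : ℕ} (hi : 1 ≤ i) (hn : i ≤ n) :
    Measurable[history A n] fun ω => ω (i, A i ω) := by
  have h : MeasurableSpace.comap (fun ω : Observations K 𝓧 => ω (i, A i ω)) inferInstance ≤
      history A n :=
    le_iSup₂_of_le i (Finset.mem_Icc.2 ⟨hi, hn⟩) le_rfl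
  exact measurable_iff_comap_le.2 h

/-- The UCB actions depend only on the past observations. -/
lemma ucbAct_adapted (M : Channels K 𝓧) (v : ℝ≥0) (W : ℕ) (tie : Finset (Fin K) → Fin K)
    (n : ℕ) : Measurable[history (ucbAct M v W tie) (n - 1)] (ucbAct M v W tie n) := by
  induction n using Nat.strong_induction_on with
  | _ n ih =>
    set A := ucbAct M v W tie with hA
    let m : MeasurableSpace (Observations K 𝓧) := history A (n - 1)
    have hact : ∀ i ∈ Finset.Ico (intervalStart W n) n, Measurable[m] (A i) := by
      intro i hi
      have hi' := Finset.mem_Ico.1 hi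
      exact (ih i hi'.2).mono (history_mono A (by omega)) le_rfl
    have heq : ∀ i ∈ Finset.Ico (intervalStart W n) n, ∀ a,
        MeasurableSet[m] {ω | A i ω = a} := fun i hi a =>
      (hact i hi) (measurableSet_singleton a)
    have hpull : ∀ a, Measurable[m] fun ω => pulls W (fun i => A i ω) n a := by
      intro a
      unfold pulls
      exact Finset.measurable_fun_sum _ fun i hi =>
        Measurable.ite (heq i hi a) measurable_const measurable_const
    have hrew : ∀ a, Measurable[m] fun ω => meanReward M W ω (fun i => A i ω) n a := by
      intro a
      unfold meanReward
      refine Measurable.div (Finset.measurable_fun_sum _ fun i hi => ?_)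
        ((measurable_from_top (f := fun k : ℕ => (k : ℝ))).comp (hpull a))
      have hi' := Finset.mem_Ico.1 hi
      have h1 : 1 ≤ i := by
        have := hi'.1
        unfold intervalStart at this
        omega
      have hobs : Measurable[m] fun ω => ω (i, A i ω) := measurable_obs A h1 (by omega)
      have h2 : Measurable[m] fun ω : Observations K 𝓧 =>
          if A i ω = a then M.llr a (ω (i, A i ω)) else 0 :=
        Measurable.ite (heq i hi a) ((M.measurable_llr a).comp hobs) measurable_const
      refine Eq.mpr ?_ h2
      congr 1
      funext ω
      by_cases h : A i ω = a
      · simp [h]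
      · simp [h]
    have hidx : ∀ a, Measurable[m] fun ω => ucbIndex M v W ω (fun i => A i ω) n a := by
      intro a
      unfold ucbIndex
      refine Measurable.ite ((hpull a) (measurableSet_singleton 0)) measurable_const ?_
      refine measurable_coe_real_ereal.comp ((hrew a).add ?_)
      exact (measurable_from_top
        (f := fun k : ℕ => √(4 * (v : ℝ) * Real.log W / (k : ℝ)))).comp (hpull a)
    have hmem : ∀ a, MeasurableSet[m] {ω | a ∈ ucbArgmax M v W ω (fun i => A i ω) n} := by
      intro a
      simp only [ucbArgmax, Finset.mem_filter, Finset.mem_univ, true_and, Set.ofPred_forall]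
      exact MeasurableSet.iInter fun a' => measurableSet_le (hidx a') (hidx a)
    have harg : ∀ s : Finset (Fin K),
        MeasurableSet[m] {ω | ucbArgmax M v W ω (fun i => A i ω) n = s} := by
      intro s
      have : {ω | ucbArgmax M v W ω (fun i => A i ω) n = s} =
          ⋂ a, {ω | a ∈ ucbArgmax M v W ω (fun i => A i ω) n ↔ a ∈ s} := by
        ext ω
        simp [Finset.ext_iff]
      rw [this]
      refine MeasurableSet.iInter fun a => ?_
      by_cases ha : a ∈ s
      · simpa [ha] using hmem a
      · have hc : MeasurableSet[m] {ω | a ∉ ucbArgmax M v W ω (fun i => A i ω) n} :=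
          (hmem a).compl
        simpa [ha] using hc
    refine measurable_to_countable' fun a => ?_
    have : A n ⁻¹' {a} = ⋃ s ∈ {s : Finset (Fin K) | tie s = a},
        {ω | ucbArgmax M v W ω (fun i => A i ω) n = s} := by
      ext ω
      simp [hA, ucbAct_eq M v W tie n ω]
    rw [this]
    exact MeasurableSet.biUnion (Set.to_countable _) fun s _ => harg s

/-- The control policy `A_UCB`: the UCB rule, restarted every `W` time-steps, with the
log-likelihood ratios of the observations as rewards. -/
def ucbPolicy (M : Channels K 𝓧) (v : ℝ≥0) (W : ℕ) (tie : Finset (Fin K) → Fin K) :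
    ControlPolicy K 𝓧 where
  act := ucbAct M v W tie
  adapted n _ := ucbAct_adapted M v W tie n

end BanditQCD

end

/-! False alarms. The Shiryaev-Roberts statistic `R_n` sums, over all starting times, the likelihood
ratios whose largest term is `exp C_n`; hence `exp C_n ≤ R_n` for `n ≥ 1`. Before the change each
selected factor has conditional mean `1`, because the action is chosen from the past, so `R_n - n`
is a martingale under every policy. Since `R ≥ γ` at the alarm, optional stopping gives a mean alarm
time of at least `γ` (`ofReal_le_meanTimeToFalseAlarm`).

Delay. The UCB statistics restart with each interval, so over an interval that starts after the
change the regret bounds hold conditionally on every earlier event, whatever was observed before. A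
stream that is unaffected or has divergence below `I` is selected often only if its average is
overestimated or the best affected stream is underestimated. Both are unlikely by exponential Markov
bounds, so such streams take a vanishing share of the `W` steps (`eventually_sum_real_act_le`). The
conditional drift per step is therefore at least any prescribed `m < I` for large `W`
(`exists_eventually_drift_ge`).

The CuSum dominates the sum of the log-likelihood ratios from any starting time, and only decreases
if these are capped at a constant `B`. The cap bounds the overshoot of one interval by `W B`. Wald's
argument over whole intervals (`mul_sum_staysBelow_le`) bounds the mean number of intervals needed
by `(b + W B) / (W m)`. Waiting for the first full interval costs at most `W`, so the delay is at
most `W + (b + W B) / m` (`worstCaseDelay_le`). As `W = o(b)` and `m` can be taken arbitrarily close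
to `I`, this is `(b / I)(1 + o(1))`. -/

noncomputable section

namespace BanditQCD

variable {K : ℕ} {𝓧 : Type*} [MeasurableSpace 𝓧]

/-! ### Histories and measurability -/

/-- The information in all observations up to time-step `n`. -/
@[reducible] def past (K : ℕ) (𝓧 : Type*) [MeasurableSpace 𝓧] (n : ℕ) :
    MeasurableSpace (Observations K 𝓧) :=
  ⨆ p ∈ {p : ℕ × Fin K | p.1 ≤ n}, MeasurableSpace.comap (fun ω => ω p) inferInstance

lemma past_mono {m n : ℕ} (h : m ≤ n) : past K 𝓧 m ≤ past K 𝓧 n :=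
  biSup_mono fun _ hp => le_trans hp h

lemma past_le (n : ℕ) : past K 𝓧 n ≤ MeasurableSpace.pi :=
  iSup₂_le fun p _ => (measurable_pi_apply p).comap_le

lemma measurable_past_apply {n : ℕ} (p : ℕ × Fin K) (hp : p.1 ≤ n) :
    Measurable[past K 𝓧 n] fun ω : Observations K 𝓧 => ω p := by
  have h : MeasurableSpace.comap (fun ω : Observations K 𝓧 => ω p) inferInstance ≤ past K 𝓧 n :=
    le_iSup₂_of_le p hp le_rfl
  exact measurable_iff_comap_le.2 h

lemma measurable_select {Ω β : Type*} {m : MeasurableSpace Ω} [MeasurableSpace β]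
    {s : Ω → Fin K} (hs : Measurable s) {f : Fin K → Ω → β} (hf : ∀ a, Measurable (f a)) :
    Measurable fun ω => f (s ω) ω := by
  intro B hB
  have : (fun ω => f (s ω) ω) ⁻¹' B = ⋃ a, s ⁻¹' {a} ∩ f a ⁻¹' B := by
    ext ω; simp
  rw [this]
  exact MeasurableSet.iUnion fun a => (hs (measurableSet_singleton a)).inter (hf a hB)

/-- The history is generated by randomly chosen coordinates. Embedding it in the σ-algebra of the
fixed coordinates up to time `n` makes independence from later observations available. -/
lemma history_le_past (A : ControlPolicy K 𝓧) (n : ℕ) : history A.act n ≤ past K 𝓧 n := by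
  induction n with
  | zero => exact iSup₂_le fun i hi => by simp at hi
  | succ n ih =>
    refine iSup₂_le fun i hi => ?_
    obtain ⟨h1, h2⟩ := Finset.mem_Icc.1 hi
    have hact : Measurable[past K 𝓧 (n + 1)] (A.act i) :=
      (A.adapted i h1).mono ((history_mono A.act (by omega)).trans
        (ih.trans (past_mono (Nat.le_succ n)))) le_rfl
    have : Measurable[past K 𝓧 (n + 1)] fun ω : Observations K 𝓧 => ω (i, A.act i ω) :=
      measurable_select (m := past K 𝓧 (n + 1)) hact
        (f := fun a (ω : Observations K 𝓧) => ω (i, a))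
        fun a => measurable_past_apply (i, a) h2
    exact measurable_iff_comap_le.1 this

lemma history_le (A : ControlPolicy K 𝓧) (n : ℕ) : history A.act n ≤ MeasurableSpace.pi :=
  (history_le_past A n).trans (past_le n)

lemma measurable_act (A : ControlPolicy K 𝓧) {i n : ℕ} (hi : 1 ≤ i) (hn : i ≤ n + 1) :
    Measurable[history A.act n] (A.act i) :=
  (A.adapted i hi).mono (history_mono A.act (by omega)) le_rfl

/-- A function of the action and of the observation at time-step `i` is determined by the
history. -/
lemma measurable_select_obs {β : Type*} [MeasurableSpace β] (A : ControlPolicy K 𝓧) {i n : ℕ}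
    (hi : 1 ≤ i) (hn : i ≤ n) {f : Fin K → 𝓧 → β} (hf : ∀ a, Measurable (f a)) :
    Measurable[history A.act n] fun ω => f (A.act i ω) (ω (i, A.act i ω)) :=
  measurable_select (m := history A.act n) (measurable_act A hi (by omega))
    (f := fun a (ω : Observations K 𝓧) => f a (ω (i, A.act i ω)))
    fun a => (hf a).comp (measurable_obs A.act hi hn)

/-! ### Independence of the next observation, and supermartingales -/

section ProductLaw

variable (q : ℕ × Fin K → Measure 𝓧) [∀ p, IsProbabilityMeasure (q p)]

lemma indep_history_obs (A : ControlPolicy K 𝓧) (n : ℕ) (a : Fin K) :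
    Indep (history A.act n)
      (MeasurableSpace.comap (fun ω : Observations K 𝓧 => ω (n + 1, a)) inferInstance)
      (Measure.infinitePi q) := by
  have hi : iIndep (fun p : ℕ × Fin K =>
      MeasurableSpace.comap (fun ω : Observations K 𝓧 => ω p) inferInstance)
      (Measure.infinitePi q) :=
    iIndepFun_infinitePi (P := q) (X := fun _ x => x) fun _ => measurable_id
  have hd : Disjoint {p : ℕ × Fin K | p.1 ≤ n} {(n + 1, a)} := by
    simp
  have := indep_iSup_of_disjoint (fun p => (measurable_pi_apply p).comap_le) hi hd
  refine indep_of_indep_of_le_left (indep_of_indep_of_le_right this ?_) (history_le_past A n)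
  exact le_iSup₂_of_le (n + 1, a) rfl le_rfl

lemma lintegral_mul_obs (A : ControlPolicy K 𝓧) (n : ℕ) (a : Fin K)
    {U : Observations K 𝓧 → ℝ≥0∞} (hU : Measurable[history A.act n] U)
    {g : 𝓧 → ℝ≥0∞} (hg : Measurable g) :
    ∫⁻ ω, U ω * g (ω (n + 1, a)) ∂Measure.infinitePi q =
      (∫⁻ ω, U ω ∂Measure.infinitePi q) * ∫⁻ x, g x ∂q (n + 1, a) := by
  have hle : MeasurableSpace.comap (fun ω : Observations K 𝓧 => ω (n + 1, a)) inferInstance ≤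
      MeasurableSpace.pi := (measurable_pi_apply (n + 1, a)).comap_le
  have hg' : Measurable[MeasurableSpace.comap (fun ω : Observations K 𝓧 => ω (n + 1, a))
      inferInstance] fun ω => g (ω (n + 1, a)) := hg.comp (comap_measurable _)
  rw [lintegral_mul_eq_lintegral_mul_lintegral_of_independent_measurableSpace (history_le A n) hle
    (indep_history_obs q A n a) hU hg', (measurePreserving_eval_infinitePi q (n + 1, a)).lintegral_comp hg]

/-- The action for time `n + 1` is already determined by the history at `n`. Splitting by its value
leaves, in each piece, a fresh observation of a fixed stream, which is independent of that history.
-/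
lemma lintegral_mul_select (A : ControlPolicy K 𝓧) (n : ℕ)
    {U : Observations K 𝓧 → ℝ≥0∞} (hU : Measurable[history A.act n] U)
    {g : Fin K → 𝓧 → ℝ≥0∞} (hg : ∀ a, Measurable (g a))
    (hg1 : ∀ a, ∫⁻ x, g a x ∂q (n + 1, a) ≤ 1) :
    ∫⁻ ω, U ω * g (A.act (n + 1) ω) (ω (n + 1, A.act (n + 1) ω)) ∂Measure.infinitePi q ≤
      ∫⁻ ω, U ω ∂Measure.infinitePi q := by
  have hs : ∀ a, MeasurableSet[history A.act n] {ω | A.act (n + 1) ω = a} := fun a =>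
    measurable_act A (by omega) le_rfl (measurableSet_singleton a)
  have hUa : ∀ a, Measurable[history A.act n]
      ({ω | A.act (n + 1) ω = a}.indicator U) := fun a => hU.indicator (hs a)
  have hsplit : ∀ V : Observations K 𝓧 → ℝ≥0∞, ∀ ω,
      V ω = ∑ a, {ω | A.act (n + 1) ω = a}.indicator V ω := by
    intro V ω
    simp [Set.indicator_apply]
  calc ∫⁻ ω, U ω * g (A.act (n + 1) ω) (ω (n + 1, A.act (n + 1) ω)) ∂Measure.infinitePi q
      = ∫⁻ ω, ∑ a, {ω | A.act (n + 1) ω = a}.indicator U ω * g a (ω (n + 1, a))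
          ∂Measure.infinitePi q := by
        refine lintegral_congr fun ω => ?_
        simp [Set.indicator_apply, ite_mul]
    _ = ∑ a, (∫⁻ ω, {ω | A.act (n + 1) ω = a}.indicator U ω ∂Measure.infinitePi q) *
          ∫⁻ x, g a x ∂q (n + 1, a) := by
        rw [lintegral_finsetSum]
        · exact Finset.sum_congr rfl fun a _ => lintegral_mul_obs q A n a (hUa a) (hg a)
        · exact fun a _ => ((hUa a).mono (history_le A n) le_rfl).mul
            ((hg a).comp (measurable_pi_apply _))
    _ ≤ ∑ a, (∫⁻ ω, {ω | A.act (n + 1) ω = a}.indicator U ω ∂Measure.infinitePi q) :=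
        Finset.sum_le_sum fun a _ => mul_le_of_le_one_right' (hg1 a)
    _ = ∫⁻ ω, U ω ∂Measure.infinitePi q := by
        rw [← lintegral_finsetSum _ fun a _ => (hUa a).mono (history_le A n) le_rfl]
        exact lintegral_congr fun ω => (hsplit U ω).symm

/-- This converts the drift of a step into selection probabilities, which is how regret bounds enter
the delay. -/
lemma setIntegral_select (A : ControlPolicy K 𝓧) (n : ℕ) {G : Set (Observations K 𝓧)}
    (hG : MeasurableSet[history A.act n] G) {f : Fin K → 𝓧 → ℝ}
    (hf : ∀ a, Measurable (f a)) (hint : ∀ a, Integrable (f a) (q (n + 1, a))) :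
    ∫ ω in G, f (A.act (n + 1) ω) (ω (n + 1, A.act (n + 1) ω)) ∂Measure.infinitePi q =
      ∑ a, (Measure.infinitePi q).real (G ∩ {ω | A.act (n + 1) ω = a}) *
        ∫ x, f a x ∂q (n + 1, a) := by
  have hs : ∀ a, MeasurableSet[history A.act n] (G ∩ {ω | A.act (n + 1) ω = a}) := fun a =>
    hG.inter (measurable_act A (by omega) le_rfl (measurableSet_singleton a))
  have hcomp : ∀ a, Integrable (fun ω : Observations K 𝓧 => f a (ω (n + 1, a)))
      (Measure.infinitePi q) := fun a =>
    (measurePreserving_eval_infinitePi q (n + 1, a)).integrable_comp_of_integrable (hint a)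
  rw [← integral_indicator (history_le A n _ hG)]
  calc _ = ∫ ω, ∑ a, (G ∩ {ω | A.act (n + 1) ω = a}).indicator
          (fun ω => f a (ω (n + 1, a))) ω ∂Measure.infinitePi q := by
        refine integral_congr_ae (.of_forall fun ω => ?_)
        by_cases h : ω ∈ G
        · have : ∀ a, (G ∩ {ω | A.act (n + 1) ω = a}).indicator
              (fun ω => f a (ω (n + 1, a))) ω =
              if A.act (n + 1) ω = a then f a (ω (n + 1, a)) else 0 := fun a => by
            classical
            rw [Set.indicator_apply]
            simp [h]
          simp only [this, Set.indicator_of_mem h, Finset.sum_ite_eq, Finset.mem_univ, if_true]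
        · simp [h]
    _ = ∑ a, ∫ ω, (G ∩ {ω | A.act (n + 1) ω = a}).indicator
          (fun ω => f a (ω (n + 1, a))) ω ∂Measure.infinitePi q :=
        integral_finsetSum _ fun a _ => (hcomp a).indicator (history_le A n _ (hs a))
    _ = _ := by
        refine Finset.sum_congr rfl fun a _ => ?_
        have hi : IndepFun ((G ∩ {ω | A.act (n + 1) ω = a}).indicator (fun _ => (1 : ℝ)))
            (fun ω : Observations K 𝓧 => f a (ω (n + 1, a))) (Measure.infinitePi q) := by
          refine indep_of_indep_of_le_left (indep_of_indep_of_le_right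
            (indep_history_obs q A n a) ?_) ?_
          · exact measurable_iff_comap_le.1 ((hf a).comp (comap_measurable _))
          · exact measurable_iff_comap_le.1 (measurable_const.indicator (hs a))
        have := hi.integral_mul_eq_mul_integral
          ((measurable_const.indicator (history_le A n _ (hs a))).aestronglyMeasurable)
          (hcomp a).aestronglyMeasurable
        rw [integral_indicator_const _ (history_le A n _ (hs a)), smul_eq_mul, mul_one] at this
        have h2 : ∫ ω, f a (ω (n + 1, a)) ∂Measure.infinitePi q = ∫ x, f a x ∂q (n + 1, a) := by
          rw [← (measurePreserving_eval_infinitePi q (n + 1, a)).map_eq, integral_map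
            (measurable_pi_apply _).aemeasurable (hf a).aestronglyMeasurable]
        rw [← h2, ← this]
        refine integral_congr_ae (.of_forall fun ω => ?_)
        by_cases h : ω ∈ G ∩ {ω | A.act (n + 1) ω = a} <;> simp [h]

/-- Products of likelihood factors of mean at most `1` form a supermartingale. -/
lemma setLIntegral_prod_select_le (A : ControlPolicy K 𝓧) (t n : ℕ) {G : Set (Observations K 𝓧)}
    (hG : MeasurableSet[history A.act t] G)
    {g : Fin K → 𝓧 → ℝ≥0∞} (hg : ∀ a, Measurable (g a))
    (hg1 : ∀ i a, t < i → ∫⁻ x, g a x ∂q (i, a) ≤ 1) :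
    ∫⁻ ω in G, ∏ i ∈ Finset.Ico (t + 1) (t + 1 + n), g (A.act i ω) (ω (i, A.act i ω))
      ∂Measure.infinitePi q ≤ Measure.infinitePi q G := by
  induction n with
  | zero => simp
  | succ n ih =>
    refine le_trans ?_ ih
    have hG' := history_le A t _ hG
    rw [← lintegral_indicator hG', ← lintegral_indicator hG']
    have hU : Measurable[history A.act (t + n)] (G.indicator fun ω =>
        ∏ i ∈ Finset.Ico (t + 1) (t + 1 + n), g (A.act i ω) (ω (i, A.act i ω))) := by
      refine Measurable.indicator ?_ (history_mono A.act (by omega) _ hG)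
      refine Finset.measurable_fun_prod _ fun i hi => ?_
      have := Finset.mem_Ico.1 hi
      exact measurable_select_obs A (by omega) (by omega) hg
    refine le_trans (le_of_eq (lintegral_congr fun ω => ?_))
      (lintegral_mul_select q A (t + n) hU hg fun a => hg1 _ a (by omega))
    by_cases h : ω ∈ G
    · simp only [Set.indicator_of_mem h]
      rw [← add_assoc, Finset.prod_Ico_succ_top (by omega : t + 1 ≤ t + 1 + n),
        show t + 1 + n = t + n + 1 by omega]
    · simp [h]

end ProductLaw

/-! ### Change of measure by the likelihood ratio -/

namespace Channels

variable (M : Channels K 𝓧)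

lemma lintegral_preMeasure (a : Fin K) {g : 𝓧 → ℝ≥0∞} (hg : Measurable g) :
    ∫⁻ x, g x ∂M.preMeasure a = ∫⁻ x, ENNReal.ofReal (M.pre a x) * g x ∂M.base := by
  unfold preMeasure
  rw [lintegral_withDensity_eq_lintegral_mul _ (M.measurable_pre a).ennreal_ofReal hg]
  rfl

lemma lintegral_postMeasure (a : Fin K) {g : 𝓧 → ℝ≥0∞} (hg : Measurable g) :
    ∫⁻ x, g x ∂M.postMeasure a = ∫⁻ x, ENNReal.ofReal (M.post a x) * g x ∂M.base := by
  unfold postMeasure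
  rw [lintegral_withDensity_eq_lintegral_mul _ (M.measurable_post a).ennreal_ofReal hg]
  rfl

/-- Common supports are essential: at points where the pre-change density vanishes no post-change
mass may be lost. -/
lemma lintegral_exp_llr_mul {a : Fin K} (hsupp : ∀ᵐ x ∂M.base, M.pre a x = 0 ↔ M.post a x = 0)
    {g : 𝓧 → ℝ≥0∞} (hg : Measurable g) :
    ∫⁻ x, ENNReal.ofReal (Real.exp (M.llr a x)) * g x ∂M.preMeasure a =
      ∫⁻ x, g x ∂M.postMeasure a := by
  have hm : Measurable fun x => ENNReal.ofReal (Real.exp (M.llr a x)) :=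
    (Real.measurable_exp.comp (M.measurable_llr a)).ennreal_ofReal
  have hmul : Measurable fun x => ENNReal.ofReal (Real.exp (M.llr a x)) * g x := hm.mul hg
  rw [M.lintegral_preMeasure a hmul, M.lintegral_postMeasure a hg]
  refine lintegral_congr_ae ?_
  filter_upwards [hsupp] with x hx
  rw [← mul_assoc, ← ENNReal.ofReal_mul (M.pre_nonneg a x)]
  congr 2
  by_cases h : M.pre a x = 0
  · rw [hx.1 h, h, zero_mul]
  · have h0 : 0 < M.pre a x := lt_of_le_of_ne (M.pre_nonneg a x) (Ne.symm h)
    have h1 : 0 < M.post a x := lt_of_le_of_ne (M.post_nonneg a x) fun h' => h (hx.2 h'.symm)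
    rw [llr, Real.exp_log (div_pos h1 h0)]
    field_simp

lemma lintegral_exp_llr {a : Fin K} (hsupp : ∀ᵐ x ∂M.base, M.pre a x = 0 ↔ M.post a x = 0) :
    ∫⁻ x, ENNReal.ofReal (Real.exp (M.llr a x)) ∂M.preMeasure a = 1 := by
  have := M.lintegral_exp_llr_mul hsupp (g := fun _ => 1) measurable_const
  simpa using this

lemma kl_eq_integral (a : Fin K) : M.kl a = ∫ x, M.llr a x ∂M.postMeasure a := by
  unfold postMeasure kl
  rw [integral_withDensity_eq_integral_toReal_smul (M.measurable_post a).ennreal_ofReal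
    (.of_forall fun _ => ENNReal.ofReal_lt_top)]
  refine integral_congr_ae (.of_forall fun x => ?_)
  simp [ENNReal.toReal_ofReal (M.post_nonneg a x), llr, mul_comm]

end Channels

/-! ### The mean time to false alarm -/

/-- The Shiryaev-Roberts statistic `R_0 = 0`, `R_n = (1 + R_{n-1}) exp LLR(A_n, X_{A_n,n})`. -/
def shiryaevRoberts (M : Channels K 𝓧) (A : ControlPolicy K 𝓧) : ℕ → Observations K 𝓧 → ℝ≥0∞
  | 0, _ => 0
  | n + 1, ω => (1 + shiryaevRoberts M A n ω) *
      ENNReal.ofReal (Real.exp (M.llr (A.act (n + 1) ω) (ω (n + 1, A.act (n + 1) ω))))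

section FalseAlarm

variable (M : Channels K 𝓧) (A : ControlPolicy K 𝓧)

lemma measurable_exp_llr (a : Fin K) :
    Measurable fun x => ENNReal.ofReal (Real.exp (M.llr a x)) :=
  (Real.measurable_exp.comp (M.measurable_llr a)).ennreal_ofReal

lemma measurable_cusum {i n : ℕ} (hn : i ≤ n) : Measurable[history A.act n] (cusum M A i) := by
  induction i with
  | zero => exact measurable_const
  | succ i ih =>
    exact ((ih (by omega)).max measurable_const).add
      (measurable_select_obs A (by omega) hn M.measurable_llr)

lemma measurable_shiryaevRoberts {i n : ℕ} (hn : i ≤ n) :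
    Measurable[history A.act n] (shiryaevRoberts M A i) := by
  induction i with
  | zero => exact measurable_const
  | succ i ih =>
    exact (measurable_const.add (ih (by omega))).mul
      (measurable_select_obs A (by omega) hn (measurable_exp_llr M))

/-- A maximum of positive terms is at most their sum. The bound fails at time `0`, where `exp C_0 =
1` and `R_0 = 0`; the alarm is only sought from time `1` on. -/
lemma exp_cusum_succ (n : ℕ) (ω : Observations K 𝓧) :
    ENNReal.ofReal (Real.exp (cusum M A (n + 1) ω)) ≤ shiryaevRoberts M A (n + 1) ω := by
  have key : ENNReal.ofReal (Real.exp (max (cusum M A n ω) 0)) ≤ 1 + shiryaevRoberts M A n ω := by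
    cases n with
    | zero => simp [cusum, shiryaevRoberts]
    | succ n =>
      rw [Real.exp_monotone.map_max, ENNReal.ofReal_max, Real.exp_zero, ENNReal.ofReal_one]
      exact max_le ((exp_cusum_succ n ω).trans le_add_self) le_self_add
  rw [cusum, shiryaevRoberts, Real.exp_add, ENNReal.ofReal_mul (Real.exp_nonneg _)]
  gcongr

/-- No alarm has been raised up to time-step `n`. -/
def noAlarm (b : ℝ) (n : ℕ) : Set (Observations K 𝓧) :=
  {ω | ∀ i ∈ Finset.Icc 1 n, cusum M A i ω < b}

lemma measurableSet_noAlarm (b : ℝ) (n : ℕ) : MeasurableSet[history A.act n] (noAlarm M A b n) := by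
  have : noAlarm M A b n = ⋂ i ∈ Finset.Icc 1 n, {ω | cusum M A i ω < b} := by
    ext ω; simp [noAlarm]
  rw [this]
  refine Finset.measurableSet_biInter _ fun i hi => ?_
  exact measurableSet_lt (measurable_cusum M A (Finset.mem_Icc.1 hi).2) measurable_const

lemma mem_noAlarm_iff (b : ℝ) (n : ℕ) (ω : Observations K 𝓧) :
    ω ∈ noAlarm M A b n ↔ (n : ℕ∞) < alarmTime M A b ω := by
  rw [← not_iff_not, not_lt]
  have := hittingAfter_le_iff (u := cusum M A) (s := Set.Ici b) (n := 1) (i := n) (ω := ω)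
  refine Iff.trans ?_ this.symm
  simp [noAlarm, and_assoc]

lemma sum_indicator_noAlarm_le (b : ℝ) (n : ℕ) (ω : Observations K 𝓧) :
    ∑ k ∈ Finset.range n, (noAlarm M A b k).indicator 1 ω ≤ (alarmTime M A b ω : ℝ≥0∞) := by
  classical
  have h1 : ∑ k ∈ Finset.range n, (noAlarm M A b k).indicator (1 : Observations K 𝓧 → ℝ≥0∞) ω =
      (((Finset.range n).filter fun k : ℕ => (k : ℕ∞) < alarmTime M A b ω).card : ℝ≥0∞) := by
    rw [Finset.card_filter]
    push_cast
    refine Finset.sum_congr rfl fun k _ => ?_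
    simp [Set.indicator_apply, mem_noAlarm_iff]
  rw [h1]
  cases h : alarmTime M A b ω with
  | top => simp
  | coe m =>
    have : (Finset.range n).filter (fun k : ℕ => (k : ℕ∞) < (m : ℕ∞)) ⊆ Finset.range m := by
      intro k hk
      simpa using (Finset.mem_filter.1 hk).2
    have := Finset.card_le_card this
    simp only [Finset.card_range] at this
    simpa using this

lemma ofReal_le_meanTimeToFalseAlarm
    (hsupp : ∀ a, ∀ᵐ x ∂M.base, M.pre a x = 0 ↔ M.post a x = 0) {γ : ℝ} (hγ : 0 < γ) :
    ENNReal.ofReal γ ≤ meanTimeToFalseAlarm M (alarmTime M A (Real.log γ)) := by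
  set b := Real.log γ with hb
  set P := M.lawNoChange with hP
  set D := noAlarm M A b with hD
  set g := ENNReal.ofReal γ with hg
  have hDm : ∀ n, MeasurableSet (D n) := fun n => history_le A n _ (measurableSet_noAlarm M A b n)
  have hanti : ∀ n, D (n + 1) ⊆ D n := fun n ω h i hi =>
    h i (Finset.Icc_subset_Icc_right (Nat.le_succ n) hi)
  have hstep : ∀ n, ∫⁻ ω in D n, shiryaevRoberts M A (n + 1) ω ∂P ≤
      P (D n) + ∫⁻ ω in D n, shiryaevRoberts M A n ω ∂P := by
    intro n
    have hU : Measurable[history A.act n]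
        ((D n).indicator fun ω => 1 + shiryaevRoberts M A n ω) :=
      (measurable_const.add (measurable_shiryaevRoberts M A le_rfl)).indicator
        (measurableSet_noAlarm M A b n)
    have := lintegral_mul_select (fun p : ℕ × Fin K => M.preMeasure p.2) A n hU
      (measurable_exp_llr M) fun a => (M.lintegral_exp_llr (hsupp a)).le
    rw [← lintegral_indicator (hDm n)]
    calc _ ≤ ∫⁻ ω, (D n).indicator (fun ω => 1 + shiryaevRoberts M A n ω) ω ∂P := by
          refine le_trans (le_of_eq (lintegral_congr fun ω => ?_)) this
          by_cases h : ω ∈ D n <;> simp [h, shiryaevRoberts]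
      _ = _ := by
          rw [lintegral_indicator (hDm n), lintegral_add_left measurable_const]
          simp
  -- Optional stopping at a finite horizon: mass not yet stopped carries `R_{n+1}`, stopped mass
  -- carries at least `γ`, and the right side is the mean of the alarm time truncated at `n + 1`.
  have hmain : ∀ n, ∫⁻ ω in D n, shiryaevRoberts M A (n + 1) ω ∂P + g * P (D n)ᶜ ≤
      ∑ k ∈ Finset.range (n + 1), P (D k) := by
    intro n
    induction n with
    | zero =>
      have h0 : D 0 = Set.univ := by ext; simp [hD, noAlarm]
      have := hstep 0
      simpa [h0, shiryaevRoberts] using this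
    | succ n ih =>
      rw [Finset.sum_range_succ]
      have hsplit : P (D (n + 1))ᶜ ≤ P (D n)ᶜ + P (D n \ D (n + 1)) := by
        refine le_trans (measure_mono fun ω hω => ?_) (measure_union_le _ _)
        by_cases h : ω ∈ D n
        · exact Or.inr ⟨h, hω⟩
        · exact Or.inl h
      -- Here the alarm is raised exactly at time `n + 1`.
      have hdiff : g * P (D n \ D (n + 1)) ≤
          ∫⁻ ω in D n \ D (n + 1), shiryaevRoberts M A (n + 1) ω ∂P := by
        rw [← setLIntegral_const]
        refine setLIntegral_mono' ((hDm n).diff (hDm (n + 1))) fun ω hω => ?_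
        refine le_trans ?_ (exp_cusum_succ M A n ω)
        refine ENNReal.ofReal_le_ofReal ?_
        rw [← Real.exp_log hγ]
        refine Real.exp_le_exp.2 (not_lt.1 fun hlt => hω.2 fun i hi => ?_)
        rcases Nat.lt_or_ge n i with h | h
        · have : i = n + 1 := by have := (Finset.mem_Icc.1 hi).2; omega
          rw [this]; exact hlt
        · exact hω.1 i (Finset.mem_Icc.2 ⟨(Finset.mem_Icc.1 hi).1, h⟩)
      have hunion : ∫⁻ ω in D (n + 1), shiryaevRoberts M A (n + 1) ω ∂P +
          ∫⁻ ω in D n \ D (n + 1), shiryaevRoberts M A (n + 1) ω ∂P =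
          ∫⁻ ω in D n, shiryaevRoberts M A (n + 1) ω ∂P := by
        have := lintegral_inter_add_sdiff (μ := P) (shiryaevRoberts M A (n + 1)) (D n) (hDm (n + 1))
        rwa [Set.inter_eq_self_of_subset_right (hanti n)] at this
      calc _ ≤ (P (D (n + 1)) + ∫⁻ ω in D (n + 1), shiryaevRoberts M A (n + 1) ω ∂P) +
            g * (P (D n)ᶜ + P (D n \ D (n + 1))) := by
            gcongr
            exact hstep (n + 1)
        _ = (∫⁻ ω in D (n + 1), shiryaevRoberts M A (n + 1) ω ∂P + g * P (D n \ D (n + 1))) +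
            g * P (D n)ᶜ + P (D (n + 1)) := by ring
        _ ≤ (∫⁻ ω in D n, shiryaevRoberts M A (n + 1) ω ∂P) + g * P (D n)ᶜ + P (D (n + 1)) := by
            rw [← hunion]; gcongr
        _ ≤ _ := by gcongr
  have hsum : ∀ n, ∑ k ∈ Finset.range n, P (D k) ≤ meanTimeToFalseAlarm M (alarmTime M A b) := by
    intro n
    have : ∑ k ∈ Finset.range n, P (D k) =
        ∫⁻ ω, ∑ k ∈ Finset.range n, (D k).indicator 1 ω ∂P := by
      rw [lintegral_finsetSum _ fun k _ => measurable_one.indicator (hDm k)]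
      exact Finset.sum_congr rfl fun k _ => (lintegral_indicator_one (hDm k)).symm
    rw [this]
    exact lintegral_mono fun ω => sum_indicator_noAlarm_le M A b n ω
  by_cases htop : meanTimeToFalseAlarm M (alarmTime M A b) = ∞
  · rw [htop]; exact le_top
  -- If the mean is finite the tail probabilities are summable, so the unstopped mass vanishes.
  have htend : Tendsto (fun n => P (D n)) atTop (𝓝 0) := by
    refine ENNReal.tendsto_atTop_zero_of_tsum_ne_top (ne_top_of_le_ne_top htop ?_)
    rw [ENNReal.tsum_eq_iSup_nat]
    exact iSup_le hsum
  have hbound : ∀ n, g ≤ g * P (D n) + meanTimeToFalseAlarm M (alarmTime M A b) := by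
    intro n
    calc g = g * (P (D n) + P (D n)ᶜ) := by rw [measure_add_measure_compl (hDm n)]; simp
      _ = g * P (D n) + g * P (D n)ᶜ := mul_add _ _ _
      _ ≤ _ := by
        gcongr
        exact (le_add_self.trans (hmain n)).trans (hsum (n + 1))
  have hlim : Tendsto (fun n => g * P (D n) + meanTimeToFalseAlarm M (alarmTime M A b)) atTop
      (𝓝 (g * 0 + meanTimeToFalseAlarm M (alarmTime M A b))) :=
    (ENNReal.Tendsto.const_mul htend (Or.inr ENNReal.ofReal_ne_top)).add tendsto_const_nhds
  rw [mul_zero, zero_add] at hlim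
  exact ge_of_tendsto' hlim hbound

end FalseAlarm

/-! ### Moments of the log-likelihood ratios -/

namespace Channels

/-- The law of the observations of stream `a` after the streams in `𝒜` have changed. -/
def changedMeasure (M : Channels K 𝓧) (𝒜 : Finset (Fin K)) (a : Fin K) : Measure 𝓧 :=
  if a ∈ 𝒜 then M.postMeasure a else M.preMeasure a

instance (M : Channels K 𝓧) (𝒜 : Finset (Fin K)) (a : Fin K) :
    IsProbabilityMeasure (M.changedMeasure 𝒜 a) := by
  unfold changedMeasure
  split_ifs <;> infer_instance

variable (M : Channels K 𝓧)

lemma lintegral_exp_llr_post_le {a : Fin K} {v : ℝ≥0}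
    (hsub : HasSubgaussianMGF (fun x => M.llr a x - M.kl a) v (M.postMeasure a)) (t s : ℝ) :
    ∫⁻ x, ENNReal.ofReal (Real.exp (t * (M.llr a x - M.kl a) + s)) ∂M.postMeasure a ≤
      ENNReal.ofReal (Real.exp (v * t ^ 2 / 2 + s)) := by
  have h1 := hsub.mgf_le t
  rw [← ofReal_integral_eq_lintegral_ofReal]
  · refine ENNReal.ofReal_le_ofReal ?_
    simp only [Real.exp_add]
    rw [integral_mul_const]
    gcongr
    exact h1
  · simp only [Real.exp_add]
    exact (hsub.integrable_exp_mul t).mul_const _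
  · exact .of_forall fun _ => Real.exp_nonneg _

/-- The post-change mean of `exp (-LLR)` is `1`, and the sub-Gaussian bound at `θ = -1` bounds it by
`exp (v / 2 - kl)`. The lemma serves to show `v > 0`. -/
lemma kl_le {a : Fin K} {v : ℝ≥0}
    (hsupp : ∀ᵐ x ∂M.base, M.pre a x = 0 ↔ M.post a x = 0)
    (hsub : HasSubgaussianMGF (fun x => M.llr a x - M.kl a) v (M.postMeasure a)) :
    M.kl a ≤ v / 2 := by
  have h1 := M.lintegral_exp_llr_mul hsupp
    (g := fun x => ENNReal.ofReal (Real.exp (-M.llr a x)))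
    (Real.measurable_exp.comp (M.measurable_llr a).neg).ennreal_ofReal
  have h2 := M.lintegral_exp_llr_post_le hsub (-1) (-M.kl a)
  have h3 : ∀ x, -1 * (M.llr a x - M.kl a) + -M.kl a = -M.llr a x := fun x => by ring
  simp only [h3, ← h1] at h2
  simp only [← ENNReal.ofReal_mul (Real.exp_nonneg _), ← Real.exp_add, add_neg_cancel,
    Real.exp_zero, ENNReal.ofReal_one, lintegral_const, measure_univ, mul_one] at h2
  rw [← ENNReal.ofReal_one, ENNReal.ofReal_le_ofReal_iff (Real.exp_nonneg _),
    Real.one_le_exp_iff] at h2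
  linarith

lemma integrable_llr_post {a : Fin K} {v : ℝ≥0}
    (hsub : HasSubgaussianMGF (fun x => M.llr a x - M.kl a) v (M.postMeasure a)) :
    Integrable (M.llr a) (M.postMeasure a) := by
  have := hsub.integrable.add (integrable_const (M.kl a))
  refine this.congr (.of_forall fun x => ?_)
  simp

/-- Only post-change moments are assumed. Since `|x| ≤ exp x + exp (-x)`, it suffices that the
pre-change mean of `exp (-LLR)`, equal to the post-change mean of `exp (-2 LLR)`, is finite. -/
lemma integrable_llr_pre {a : Fin K} {v : ℝ≥0}
    (hsupp : ∀ᵐ x ∂M.base, M.pre a x = 0 ↔ M.post a x = 0)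
    (hsub : HasSubgaussianMGF (fun x => M.llr a x - M.kl a) v (M.postMeasure a)) :
    Integrable (M.llr a) (M.preMeasure a) := by
  have hint : ∀ f : 𝓧 → ℝ, Measurable f →
      ∫⁻ x, ENNReal.ofReal (Real.exp (f x)) ∂M.preMeasure a ≠ ∞ →
      Integrable (fun x => Real.exp (f x)) (M.preMeasure a) := by
    intro f hf h
    exact ⟨(Real.measurable_exp.comp hf).aestronglyMeasurable,
      (hasFiniteIntegral_iff_ofReal (.of_forall fun _ => Real.exp_nonneg _)).2 h.lt_top⟩
  have h1 := hint (M.llr a) (M.measurable_llr a) (by simp [M.lintegral_exp_llr hsupp])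
  have h2 := hint (fun x => -M.llr a x) (M.measurable_llr a).neg (by
    have e := M.lintegral_exp_llr_mul hsupp
      (g := fun x => ENNReal.ofReal (Real.exp (-2 * M.llr a x)))
      (Real.measurable_exp.comp ((M.measurable_llr a).const_mul _)).ennreal_ofReal
    have h3 : ∀ x, M.llr a x + -2 * M.llr a x = -M.llr a x := fun x => by ring
    simp only [← ENNReal.ofReal_mul (Real.exp_nonneg _), ← Real.exp_add, h3] at e
    rw [e]
    refine ne_top_of_le_ne_top ENNReal.ofReal_ne_top
      (le_trans (le_of_eq (lintegral_congr fun x => ?_))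
        (M.lintegral_exp_llr_post_le hsub (-2) (-2 * M.kl a)))
    congr 2
    ring)
  refine (h1.add h2).mono' (M.measurable_llr a).aestronglyMeasurable (.of_forall fun x => ?_)
  rw [Real.norm_eq_abs]
  refine abs_le'.2 ⟨?_, ?_⟩
  · have := Real.add_one_le_exp (M.llr a x)
    have := Real.exp_pos (-M.llr a x)
    simp only [Pi.add_apply]; linarith
  · have := Real.add_one_le_exp (-M.llr a x)
    have := Real.exp_pos (M.llr a x)
    simp only [Pi.add_apply]; linarith

lemma integrable_llr_changed {a : Fin K} {v : ℝ≥0} (𝒜 : Finset (Fin K))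
    (hsupp : ∀ᵐ x ∂M.base, M.pre a x = 0 ↔ M.post a x = 0)
    (hsub : HasSubgaussianMGF (fun x => M.llr a x - M.kl a) v (M.postMeasure a)) :
    Integrable (M.llr a) (M.changedMeasure 𝒜 a) := by
  unfold changedMeasure
  split_ifs
  exacts [M.integrable_llr_post hsub, M.integrable_llr_pre hsupp hsub]

lemma integrable_min_llr {a : Fin K} {μ : Measure 𝓧} [IsFiniteMeasure μ]
    (h : Integrable (M.llr a) μ) (B : ℝ) : Integrable (fun x => min (M.llr a x) B) μ :=
  h.inf (integrable_const B)

/-- Capping the log-likelihood ratios at a high level costs little drift. -/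
lemma exists_integral_min_llr_ge {v : ℝ≥0}
    (hsub : ∀ a, HasSubgaussianMGF (fun x => M.llr a x - M.kl a) v (M.postMeasure a))
    {ε : ℝ} (hε : 0 < ε) :
    ∃ B : ℝ, 0 ≤ B ∧ ∀ a, M.kl a - ε ≤ ∫ x, min (M.llr a x) B ∂M.postMeasure a := by
  have key : ∀ a, ∀ᶠ n : ℕ in atTop,
      M.kl a - ε ≤ ∫ x, min (M.llr a x) (n : ℝ) ∂M.postMeasure a := by
    intro a
    have hlim : Tendsto (fun n : ℕ => ∫ x, min (M.llr a x) (n : ℝ) ∂M.postMeasure a) atTop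
        (𝓝 (∫ x, M.llr a x ∂M.postMeasure a)) := by
      refine tendsto_integral_of_dominated_convergence (fun x => |M.llr a x|)
        (fun n => ((M.measurable_llr a).min measurable_const).aestronglyMeasurable)
        (M.integrable_llr_post (hsub a)).abs (fun n => .of_forall fun x => ?_)
        (.of_forall fun x => ?_)
      · rw [Real.norm_eq_abs]
        have hn : (0 : ℝ) ≤ n := n.cast_nonneg
        rcases le_total (M.llr a x) n with h | h
        · rw [min_eq_left h]
        · rw [min_eq_right h, abs_of_nonneg hn]
          exact h.trans (le_abs_self _)
      · refine tendsto_const_nhds.congr' ?_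
        filter_upwards [eventually_ge_atTop ⌈M.llr a x⌉₊] with n hn
        exact (min_eq_left (Nat.ceil_le.1 hn)).symm
    rw [← M.kl_eq_integral a] at hlim
    exact hlim.eventually_const_le (by linarith)
  obtain ⟨n, hn⟩ := (eventually_all.2 key).exists
  exact ⟨n, n.cast_nonneg, hn⟩

/-- A stream that is unaffected, or has a divergence below `I`, has log-likelihood ratios whose
averages exceed a level below `I` with exponentially small probability only. -/
lemma exists_exp_llr_le {v : ℝ≥0} (𝒜 : Finset (Fin K)) {I : ℝ} (hI : 0 < I) {a : Fin K}
    (hsupp : ∀ᵐ x ∂M.base, M.pre a x = 0 ↔ M.post a x = 0) (hkl : 0 < M.kl a)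
    (hsub : HasSubgaussianMGF (fun x => M.llr a x - M.kl a) v (M.postMeasure a))
    (ha : a ∈ 𝒜 → M.kl a < I) :
    ∃ δ c θ : ℝ, 0 < δ ∧ 0 < c ∧ 0 < θ ∧
      ∫⁻ x, ENNReal.ofReal (Real.exp (θ * (M.llr a x - (I - δ)) + c)) ∂M.changedMeasure 𝒜 a ≤ 1 := by
  unfold changedMeasure
  split_ifs with hmem
  -- With half the gap as `δ`, the level `I - δ` lies `δ` above the divergence. The tilt `δ / v`
  -- optimizes the Chernoff bound and yields the rate `δ ^ 2 / (2 v)`.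
  · have hv : 0 < (v : ℝ) := by linarith [M.kl_le hsupp hsub]
    have hδ : 0 < (I - M.kl a) / 2 := by linarith [ha hmem]
    set δ := (I - M.kl a) / 2 with hδdef
    refine ⟨δ, δ ^ 2 / (2 * v), δ / v, hδ, by positivity, by positivity, ?_⟩
    have := M.lintegral_exp_llr_post_le hsub (δ / v) (- (δ / v) * δ + δ ^ 2 / (2 * v))
    have e : (v : ℝ) * (δ / v) ^ 2 / 2 + (- (δ / v) * δ + δ ^ 2 / (2 * v)) = 0 := by
      field_simp; ring
    rw [e, Real.exp_zero, ENNReal.ofReal_one] at this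
    refine le_trans (le_of_eq (lintegral_congr fun x => ?_)) this
    congr 2
    have : I - δ = M.kl a + δ := by rw [hδdef]; ring
    rw [this]; ring
  -- For an unaffected stream no sub-Gaussian bound is needed: with these constants the exponent is
  -- the log-likelihood ratio itself, whose exponential has mean `1`.
  · refine ⟨I / 2, I / 2, 1, by positivity, by positivity, one_pos, ?_⟩
    refine le_trans (le_of_eq (lintegral_congr fun x => ?_)) (M.lintegral_exp_llr hsupp).le
    congr 2
    ring

end Channels

namespace Channels

/-- The law of the observation of stream `p.2` at time-step `p.1`. -/
def obsLaw (M : Channels K 𝓧) (𝒜 : Finset (Fin K)) (ν : ℕ) (p : ℕ × Fin K) : Measure 𝓧 :=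
  if ν ≤ p.1 ∧ p.2 ∈ 𝒜 then M.postMeasure p.2 else M.preMeasure p.2

instance (M : Channels K 𝓧) (𝒜 : Finset (Fin K)) (ν : ℕ) (p : ℕ × Fin K) :
    IsProbabilityMeasure (M.obsLaw 𝒜 ν p) := by
  unfold obsLaw
  split_ifs <;> infer_instance

lemma law_eq_infinitePi (M : Channels K 𝓧) (𝒜 : Finset (Fin K)) (ν : ℕ) :
    M.law 𝒜 ν = Measure.infinitePi (M.obsLaw 𝒜 ν) := rfl

lemma obsLaw_of_le (M : Channels K 𝓧) (𝒜 : Finset (Fin K)) {ν i : ℕ} (h : ν ≤ i) (a : Fin K) :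
    M.obsLaw 𝒜 ν (i, a) = M.changedMeasure 𝒜 a := by
  simp [obsLaw, changedMeasure, h]

end Channels

/-- Each step counted here raises the running count of `p` by one, so at most `u` of them start from
a count below `u`. The minimum with the running count makes the induction close. -/
lemma sum_range_lt_card_le {p : ℕ → Prop} [DecidablePred p] (u n : ℕ) :
    ∑ r ∈ Finset.range n,
      (if p r ∧ ∑ i ∈ Finset.range r, (if p i then 1 else 0) < u then 1 else 0) ≤ u := by
  suffices h : ∑ r ∈ Finset.range n,
      (if p r ∧ ∑ i ∈ Finset.range r, (if p i then 1 else 0) < u then 1 else 0) ≤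
        min u (∑ i ∈ Finset.range n, (if p i then 1 else 0)) from h.trans (min_le_left _ _)
  induction n with
  | zero => simp
  | succ n ih =>
    rw [Finset.sum_range_succ, Finset.sum_range_succ]
    have := le_min_iff.1 ih
    by_cases h : p n
    · simp only [h, true_and, if_true, le_min_iff]
      split_ifs <;> constructor <;> omega
    · simpa [h] using this

/-! ### Deviation bounds under adaptive sampling -/

section Concentration

variable (M : Channels K 𝓧) (𝒜 : Finset (Fin K)) {ν : ℕ} (A : ControlPolicy K 𝓧)

/-- The number of selections of stream `a` among the first `n` time-steps after `t`. -/
def pullCount (A : ControlPolicy K 𝓧) (t n : ℕ) (a : Fin K) (ω : Observations K 𝓧) : ℕ :=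
  ∑ i ∈ Finset.range n, if A.act (t + 1 + i) ω = a then 1 else 0

/-- The sum of the rewards of stream `a` over the first `n` time-steps after `t`. -/
def rewardSum (t n : ℕ) (a : Fin K) (ω : Observations K 𝓧) : ℝ :=
  ∑ i ∈ Finset.range n, if A.act (t + 1 + i) ω = a then M.llr a (ω (t + 1 + i, a)) else 0

lemma sum_affine_reward (t n : ℕ) (a : Fin K) (ω : Observations K 𝓧) (θ x c : ℝ) :
    ∑ i ∈ Finset.range n, (if A.act (t + 1 + i) ω = a then
      θ * (M.llr a (ω (t + 1 + i, a)) - x) + c else 0) =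
      θ * (rewardSum M A t n a ω - x * pullCount A t n a ω) + c * pullCount A t n a ω := by
  unfold rewardSum pullCount
  push_cast
  rw [Finset.mul_sum, Finset.mul_sum, ← Finset.sum_sub_distrib, Finset.mul_sum,
    ← Finset.sum_add_distrib]
  refine Finset.sum_congr rfl fun i _ => ?_
  split_ifs <;> ring

/-- Markov's inequality for the exponential supermartingale that uses the factor `exp φ` when `a` is
selected and `1` otherwise. The random number of selections thus needs no separate treatment. -/
lemma measure_le_sum_le {t n : ℕ} (hν : ν ≤ t + 1) {G : Set (Observations K 𝓧)}
    (hG : MeasurableSet[history A.act t] G) (a : Fin K) {φ : 𝓧 → ℝ} (hφ : Measurable φ)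
    (h1 : ∫⁻ x, ENNReal.ofReal (Real.exp (φ x)) ∂M.changedMeasure 𝒜 a ≤ 1) (y : ℝ) :
    M.law 𝒜 ν (G ∩ {ω | y ≤ ∑ i ∈ Finset.range n,
      if A.act (t + 1 + i) ω = a then φ (ω (t + 1 + i, a)) else 0}) ≤
      ENNReal.ofReal (Real.exp (-y)) * M.law 𝒜 ν G := by
  set P := M.law 𝒜 ν with hP
  set g : Fin K → 𝓧 → ℝ≥0∞ := fun b x => if b = a then ENNReal.ofReal (Real.exp (φ x)) else 1
    with hg
  have hgm : ∀ b, Measurable (g b) := by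
    intro b
    by_cases hb : b = a
    · simpa [hg, hb] using (Real.measurable_exp.comp hφ).ennreal_ofReal
    · simp [hg, hb]
  have hg1 : ∀ i b, t < i → ∫⁻ x, g b x ∂M.obsLaw 𝒜 ν (i, b) ≤ 1 := by
    intro i b hi
    by_cases hb : b = a
    · simpa [hg, hb, M.obsLaw_of_le 𝒜 (show ν ≤ i by omega)] using h1
    · simp [hg, hb]
  have hS := setLIntegral_prod_select_le (M.obsLaw 𝒜 ν) A t n hG hgm hg1
  rw [← M.law_eq_infinitePi, ← hP] at hS
  have hprod : ∀ ω : Observations K 𝓧,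
      ∏ i ∈ Finset.Ico (t + 1) (t + 1 + n), g (A.act i ω) (ω (i, A.act i ω)) =
      ENNReal.ofReal (Real.exp (∑ i ∈ Finset.range n,
        if A.act (t + 1 + i) ω = a then φ (ω (t + 1 + i, a)) else 0)) := by
    intro ω
    rw [Finset.prod_Ico_eq_prod_range, add_tsub_cancel_left, Real.exp_sum,
      ENNReal.ofReal_prod_of_nonneg fun _ _ => Real.exp_nonneg _]
    refine Finset.prod_congr rfl fun i _ => ?_
    by_cases h : A.act (t + 1 + i) ω = a <;> simp [hg, h]
  simp only [hprod] at hS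
  have hmeas : Measurable fun ω : Observations K 𝓧 =>
      ENNReal.ofReal (Real.exp (∑ i ∈ Finset.range n,
        if A.act (t + 1 + i) ω = a then φ (ω (t + 1 + i, a)) else 0)) := by
    refine (Real.measurable_exp.comp (Finset.measurable_fun_sum _ fun i _ => ?_)).ennreal_ofReal
    refine Measurable.ite ?_ (hφ.comp (measurable_pi_apply _)) measurable_const
    exact history_le A (t + i) _
      (measurable_act A (by omega) (by omega) (measurableSet_singleton a))
  have hmarkov := mul_meas_ge_le_lintegral (μ := P.restrict G) hmeas
    (ENNReal.ofReal (Real.exp y))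
  have hle : ENNReal.ofReal (Real.exp y) * P (G ∩ {ω | y ≤ ∑ i ∈ Finset.range n,
      if A.act (t + 1 + i) ω = a then φ (ω (t + 1 + i, a)) else 0}) ≤ P G := by
    refine le_trans ?_ (hmarkov.trans hS)
    refine mul_le_mul_right ?_ _
    rw [Set.inter_comm]
    refine le_trans (measure_mono ?_) (Measure.le_restrict_apply _ _)
    refine Set.inter_subset_inter_left _ fun ω hω => ?_
    exact ENNReal.ofReal_le_ofReal (Real.exp_le_exp.2 hω)
  calc _ = ENNReal.ofReal (Real.exp (-y)) * (ENNReal.ofReal (Real.exp y) *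
        P (G ∩ {ω | y ≤ ∑ i ∈ Finset.range n,
          if A.act (t + 1 + i) ω = a then φ (ω (t + 1 + i, a)) else 0})) := by
        rw [← mul_assoc, ← ENNReal.ofReal_mul (Real.exp_nonneg _), ← Real.exp_add]
        simp
    _ ≤ _ := by gcongr

/-- A well-sampled stream rarely looks much better than it is. -/
lemma measure_overestimate_le {t n u : ℕ} (hν : ν ≤ t + 1) {G : Set (Observations K 𝓧)}
    (hG : MeasurableSet[history A.act t] G) {a : Fin K} {x c θ : ℝ} (hc : 0 ≤ c) (hθ : 0 ≤ θ)
    (h1 : ∫⁻ y, ENNReal.ofReal (Real.exp (θ * (M.llr a y - x) + c)) ∂M.changedMeasure 𝒜 a ≤ 1) :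
    M.law 𝒜 ν (G ∩ {ω | u ≤ pullCount A t n a ω ∧
      x * pullCount A t n a ω ≤ rewardSum M A t n a ω}) ≤
      ENNReal.ofReal (Real.exp (-(c * u))) * M.law 𝒜 ν G := by
  refine le_trans (measure_mono ?_) (measure_le_sum_le M 𝒜 A (n := n) hν hG a
    ((((M.measurable_llr a).sub_const x).const_mul θ).add_const c) h1 (c * u))
  refine Set.inter_subset_inter_right _ fun ω hω => ?_
  rw [Set.mem_ofPred_eq, sum_affine_reward]
  have h2 : (u : ℝ) ≤ pullCount A t n a ω := by exact_mod_cast hω.1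
  have h3 := mul_nonneg hθ (sub_nonneg.2 hω.2)
  nlinarith [mul_le_mul_of_nonneg_left h2 hc]

lemma pullCount_le (t n : ℕ) (a : Fin K) (ω : Observations K 𝓧) : pullCount A t n a ω ≤ n := by
  unfold pullCount
  refine (Finset.sum_le_card_nsmul _ _ 1 fun i _ => ?_).trans (by simp)
  split_ifs <;> simp

/-- The upper confidence bound of an affected stream rarely falls below its divergence. -/
lemma measure_underestimate_le {v : ℝ≥0} (hv : 0 < v) {t n W : ℕ} (hν : ν ≤ t + 1) (hn : n ≤ W)
    (hW : 1 ≤ W) {G : Set (Observations K 𝓧)}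
    (hG : MeasurableSet[history A.act t] G) {a : Fin K} (ha : a ∈ 𝒜)
    (hsub : HasSubgaussianMGF (fun x => M.llr a x - M.kl a) v (M.postMeasure a)) :
    M.law 𝒜 ν (G ∩ {ω | pullCount A t n a ω ≠ 0 ∧
      rewardSum M A t n a ω + pullCount A t n a ω *
        √(4 * (v : ℝ) * Real.log W / (pullCount A t n a ω : ℝ)) ≤
          M.kl a * pullCount A t n a ω}) ≤
      ENNReal.ofReal (1 / W) * M.law 𝒜 ν G := by
  have hWpos : (0 : ℝ) < W := by exact_mod_cast hW
  have hv' : (0 : ℝ) < v := hv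
  have hlog : 0 ≤ Real.log W := Real.log_nonneg (by exact_mod_cast hW)
  -- The optimal tilt `-s / v` depends on the sample size, so that size is fixed to `k`. The
  -- deviation gains `4 log W` and the normalization costs `2 log W`.
  have hk : ∀ k ∈ Finset.Icc 1 W, M.law 𝒜 ν (G ∩ {ω | pullCount A t n a ω = k ∧
      rewardSum M A t n a ω + k * √(4 * (v : ℝ) * Real.log W / (k : ℝ)) ≤ M.kl a * k}) ≤
      ENNReal.ofReal (Real.exp (-(2 * Real.log W))) * M.law 𝒜 ν G := by
    intro k hk
    have hk0 : (0 : ℝ) < k := by exact_mod_cast (Finset.mem_Icc.1 hk).1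
    set s := √(4 * (v : ℝ) * Real.log W / (k : ℝ)) with hs
    have hs0 : 0 ≤ s := Real.sqrt_nonneg _
    have hs2 : k * s ^ 2 = 4 * v * Real.log W := by
      rw [hs, Real.sq_sqrt (by positivity)]; field_simp
    have h1 : ∫⁻ y, ENNReal.ofReal (Real.exp
        (-(s / v) * (M.llr a y - M.kl a) + -(s ^ 2 / (2 * v)))) ∂M.changedMeasure 𝒜 a ≤ 1 := by
      have := M.lintegral_exp_llr_post_le hsub (-(s / v)) (-(s ^ 2 / (2 * v)))
      have e : (v : ℝ) * (-(s / v)) ^ 2 / 2 + -(s ^ 2 / (2 * v)) = 0 := by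
        field_simp; ring
      rw [e, Real.exp_zero, ENNReal.ofReal_one] at this
      simpa [Channels.changedMeasure, ha] using this
    refine le_trans (measure_mono ?_) (measure_le_sum_le M 𝒜 A (n := n) hν hG a
      ((((M.measurable_llr a).sub_const (M.kl a)).const_mul (-(s / v))).add_const
        (-(s ^ 2 / (2 * v)))) h1 (2 * Real.log W))
    refine Set.inter_subset_inter_right _ fun ω hω => ?_
    rw [Set.mem_ofPred_eq, sum_affine_reward, hω.1]
    have h2 : k * s ≤ M.kl a * k - rewardSum M A t n a ω := by linarith [hω.2]
    have h3 := mul_le_mul_of_nonneg_left h2 (div_nonneg hs0 hv'.le)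
    have e1 : s / v * (k * s) = 4 * Real.log W := by
      rw [show s / v * (k * s) = (k * s ^ 2) / v by ring, hs2]; field_simp
    have e2 : s ^ 2 / (2 * v) * k = 2 * Real.log W := by
      rw [show s ^ 2 / (2 * v) * k = (k * s ^ 2) / (2 * v) by ring, hs2]; field_simp; ring
    linarith
  have hsubset : G ∩ {ω | pullCount A t n a ω ≠ 0 ∧
      rewardSum M A t n a ω + pullCount A t n a ω *
        √(4 * (v : ℝ) * Real.log W / (pullCount A t n a ω : ℝ)) ≤
          M.kl a * pullCount A t n a ω} ⊆
      ⋃ k ∈ Finset.Icc 1 W, G ∩ {ω | pullCount A t n a ω = k ∧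
        rewardSum M A t n a ω + k * √(4 * (v : ℝ) * Real.log W / (k : ℝ)) ≤ M.kl a * k} := by
    intro ω hω
    simp only [Set.mem_iUnion]
    refine ⟨pullCount A t n a ω, Finset.mem_Icc.2 ⟨?_, ?_⟩, hω.1, rfl, hω.2.2⟩
    · exact Nat.one_le_iff_ne_zero.2 hω.2.1
    · exact (pullCount_le A t n a ω).trans hn
  refine (measure_mono hsubset).trans ((measure_biUnion_finset_le _ _).trans
    ((Finset.sum_le_sum hk).trans ?_))
  -- At most `W` sample sizes, each with conditional probability at most `W ^ (-2)`.
  rw [Finset.sum_const, Nat.card_Icc, add_tsub_cancel_right, nsmul_eq_mul, ← mul_assoc]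
  gcongr
  rw [← ENNReal.ofReal_natCast, ← ENNReal.ofReal_mul hWpos.le]
  refine le_of_eq (congrArg _ ?_)
  rw [Real.exp_neg, two_mul, Real.exp_add, Real.exp_log hWpos]
  field_simp

end Concentration

/-! ### Why UCB selects an inferior stream -/

section Regret

variable (M : Channels K 𝓧) (v : ℝ≥0) (W : ℕ) (tie : Finset (Fin K) → Fin K)

lemma intervalStart_eq {k r : ℕ} (hr : r < W) : intervalStart W (k * W + 1 + r) = k * W + 1 := by
  unfold intervalStart
  have : (k * W + 1 + r - 1) / W = k := by
    rw [show k * W + 1 + r - 1 = k * W + r by omega]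
    rw [Nat.div_eq_iff (by omega)]
    constructor
    · omega
    · have : k * W + W = (k + 1) * W := by ring
      omega
  rw [this]

lemma pulls_ucb {k r : ℕ} (hr : r < W) (ω : Observations K 𝓧) (a : Fin K) :
    pulls W (fun i => ucbAct M v W tie i ω) (k * W + 1 + r) a =
      pullCount (ucbPolicy M v W tie) (k * W) r a ω := by
  unfold pulls pullCount
  rw [intervalStart_eq W hr, Finset.sum_Ico_eq_sum_range, add_tsub_cancel_left]
  rfl

lemma meanReward_ucb {k r : ℕ} (hr : r < W) (ω : Observations K 𝓧) (a : Fin K) :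
    meanReward M W ω (fun i => ucbAct M v W tie i ω) (k * W + 1 + r) a =
      rewardSum M (ucbPolicy M v W tie) (k * W) r a ω /
        pullCount (ucbPolicy M v W tie) (k * W) r a ω := by
  unfold meanReward
  rw [pulls_ucb M v W tie hr]
  congr 1
  unfold rewardSum
  rw [intervalStart_eq W hr, Finset.sum_Ico_eq_sum_range, add_tsub_cancel_left]
  refine Finset.sum_congr rfl fun i _ => ?_
  by_cases h : ucbAct M v W tie (k * W + 1 + i) ω = a <;> simp [ucbPolicy, h]

lemma ucbIndex_le_ucbIndex_ucbAct
    (htie : ∀ s : Finset (Fin K), s.Nonempty → tie s ∈ s) (n : ℕ) (ω : Observations K 𝓧)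
    (a : Fin K) :
    ucbIndex M v W ω (fun i => ucbAct M v W tie i ω) n a ≤
      ucbIndex M v W ω (fun i => ucbAct M v W tie i ω) n (ucbAct M v W tie n ω) := by
  have hne : (ucbArgmax M v W ω (fun i => ucbAct M v W tie i ω) n).Nonempty := by
    obtain ⟨b, -, hb⟩ := Finset.exists_max_image Finset.univ
      (ucbIndex M v W ω (fun i => ucbAct M v W tie i ω) n) ⟨a, Finset.mem_univ a⟩
    exact ⟨b, Finset.mem_filter.2 ⟨Finset.mem_univ b, fun a' => hb a' (Finset.mem_univ a')⟩⟩
  have := htie _ hne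
  rw [← ucbAct_eq M v W tie n ω] at this
  exact (Finset.mem_filter.1 this).2 a

/-- The UCB rule selects a well-sampled stream only if that stream is overestimated or
a given other stream is underestimated. -/
lemma overestimate_or_underestimate
    (htie : ∀ s : Finset (Fin K), s.Nonempty → tie s ∈ s) {k r u : ℕ} (hr : r < W) (hu : 0 < u)
    {δ I : ℝ} (hδ : 0 ≤ δ) (hδu : 4 * v * Real.log W ≤ δ ^ 2 * u) {ω : Observations K 𝓧}
    {a : Fin K} (b : Fin K) (ha : (ucbPolicy M v W tie).act (k * W + 1 + r) ω = a)
    (hua : u ≤ pullCount (ucbPolicy M v W tie) (k * W) r a ω) :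
    ((I - δ) * pullCount (ucbPolicy M v W tie) (k * W) r a ω ≤
      rewardSum M (ucbPolicy M v W tie) (k * W) r a ω) ∨
    (pullCount (ucbPolicy M v W tie) (k * W) r b ω ≠ 0 ∧
      rewardSum M (ucbPolicy M v W tie) (k * W) r b ω +
        pullCount (ucbPolicy M v W tie) (k * W) r b ω *
        √(4 * (v : ℝ) * Real.log W / (pullCount (ucbPolicy M v W tie) (k * W) r b ω : ℝ)) ≤
          I * pullCount (ucbPolicy M v W tie) (k * W) r b ω) := by
  have hle := ucbIndex_le_ucbIndex_ucbAct M v W tie htie (k * W + 1 + r) ω b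
  rw [show ucbAct M v W tie (k * W + 1 + r) ω = a from ha] at hle
  unfold ucbIndex at hle
  rw [pulls_ucb M v W tie hr, pulls_ucb M v W tie hr, meanReward_ucb M v W tie hr,
    meanReward_ucb M v W tie hr, if_neg (show pullCount (ucbPolicy M v W tie) (k * W) r a ω ≠ 0 by
      omega)] at hle
  set Na := pullCount (ucbPolicy M v W tie) (k * W) r a ω
  set Nb := pullCount (ucbPolicy M v W tie) (k * W) r b ω
  set Sa := rewardSum M (ucbPolicy M v W tie) (k * W) r a ω
  set Sb := rewardSum M (ucbPolicy M v W tie) (k * W) r b ω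
  by_cases hNb : Nb = 0
  · rw [if_pos hNb, top_le_iff] at hle
    exact absurd hle (EReal.coe_ne_top _)
  rw [if_neg hNb, EReal.coe_le_coe_iff] at hle
  have hNb' : (0 : ℝ) < Nb := by exact_mod_cast Nat.pos_of_ne_zero hNb
  have hu' : (0 : ℝ) < u := by exact_mod_cast hu
  have hua' : (u : ℝ) ≤ Na := by exact_mod_cast hua
  have hNa' : (0 : ℝ) < Na := hu'.trans_le hua'
  -- After `u` selections the confidence radius is at most `δ`, so a non-overestimated `a` has index
  -- below `I`, which a non-underestimated `b` exceeds.
  have hsq : √(4 * (v : ℝ) * Real.log W / (Na : ℝ)) ≤ δ := by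
    refine Real.sqrt_le_iff.2 ⟨hδ, ?_⟩
    rw [div_le_iff₀ hNa']
    exact hδu.trans (mul_le_mul_of_nonneg_left hua' (sq_nonneg δ))
  by_contra! hcon
  have h1 : Sa / Na < I - δ := by rw [div_lt_iff₀ hNa']; exact hcon.1
  have h2 := hcon.2 hNb
  have h3 : I < Sb / Nb + √(4 * (v : ℝ) * Real.log W / (Nb : ℝ)) := by
    have : Sb / Nb + √(4 * (v : ℝ) * Real.log W / (Nb : ℝ)) =
      (Sb + Nb * √(4 * (v : ℝ) * Real.log W / (Nb : ℝ))) / Nb := by field_simp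
    rw [this, lt_div_iff₀ hNb']; exact h2
  linarith

end Regret

/-! ### Selection frequencies and the drift over one interval -/

section Drift

variable (M : Channels K 𝓧) (𝒜 : Finset (Fin K)) (v : ℝ≥0) (tie : Finset (Fin K) → Fin K)

lemma measurableSet_act_eq (A : ControlPolicy K 𝓧) (i : ℕ) (hi : 1 ≤ i) (a : Fin K) :
    MeasurableSet {ω | A.act i ω = a} :=
  history_le A (i - 1) _ (measurable_act A hi (by omega) (measurableSet_singleton a))

lemma measurable_pullCount (A : ControlPolicy K 𝓧) (t n : ℕ) (a : Fin K) :
    Measurable (pullCount A t n a) :=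
  Finset.measurable_fun_sum _ fun i _ =>
    Measurable.ite (measurableSet_act_eq A (t + 1 + i) (by omega) a) measurable_const
      measurable_const

lemma sum_measure_undersampled_le (A : ControlPolicy K 𝓧) (P : Measure (Observations K 𝓧))
    (G : Set (Observations K 𝓧)) (t n u : ℕ) (a : Fin K) :
    ∑ r ∈ Finset.range n,
      P (G ∩ {ω | A.act (t + 1 + r) ω = a ∧ pullCount A t r a ω < u}) ≤ u * P G := by
  classical
  have hE : ∀ r, MeasurableSet {ω | A.act (t + 1 + r) ω = a ∧ pullCount A t r a ω < u} := fun r =>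
    (measurableSet_act_eq A (t + 1 + r) (by omega) a).inter
      (measurableSet_lt (measurable_pullCount A t r a) measurable_const)
  calc _ = ∑ r ∈ Finset.range n, ∫⁻ ω in G,
        {ω | A.act (t + 1 + r) ω = a ∧ pullCount A t r a ω < u}.indicator 1 ω ∂P := by
        refine Finset.sum_congr rfl fun r _ => ?_
        rw [lintegral_indicator_one (hE r), Measure.restrict_apply (hE r), Set.inter_comm]
    _ = ∫⁻ ω in G, ∑ r ∈ Finset.range n,
        {ω | A.act (t + 1 + r) ω = a ∧ pullCount A t r a ω < u}.indicator 1 ω ∂P :=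
        (lintegral_finsetSum _ fun r _ => measurable_one.indicator (hE r)).symm
    _ ≤ ∫⁻ _ in G, (u : ℝ≥0∞) ∂P := by
        refine lintegral_mono fun ω => ?_
        have := sum_range_lt_card_le (p := fun i => A.act (t + 1 + i) ω = a) u n
        calc _ = ((∑ r ∈ Finset.range n, (if A.act (t + 1 + r) ω = a ∧ ∑ i ∈ Finset.range r,
              (if A.act (t + 1 + i) ω = a then 1 else 0) < u then 1 else 0) : ℕ) : ℝ≥0∞) := by
              push_cast
              refine Finset.sum_congr rfl fun r _ => ?_
              simp [Set.indicator_apply, pullCount]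
          _ ≤ _ := by exact_mod_cast this
    _ = u * P G := by rw [setLIntegral_const]

/-- The three terms count the selections with fewer than `u` samples, those due to overestimating
`a`, and those due to underestimating `b`; the last have probability at most `1 / W` per step. -/
lemma sum_measure_act_le (htie : ∀ s : Finset (Fin K), s.Nonempty → tie s ∈ s) (hv : 0 < v)
    {k W u ν : ℕ} (hW : 1 ≤ W) (hν : ν ≤ k * W + 1) {G : Set (Observations K 𝓧)}
    (hG : MeasurableSet[history (ucbPolicy M v W tie).act (k * W)] G) {a b : Fin K} (hb : b ∈ 𝒜)
    (hsub : HasSubgaussianMGF (fun x => M.llr b x - M.kl b) v (M.postMeasure b))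
    {δ c θ : ℝ} (hδ : 0 ≤ δ) (hc : 0 ≤ c) (hθ : 0 ≤ θ) (hu : 0 < u)
    (hδu : 4 * v * Real.log W ≤ δ ^ 2 * u)
    (h1 : ∫⁻ y, ENNReal.ofReal (Real.exp (θ * (M.llr a y - (M.kl b - δ)) + c))
      ∂M.changedMeasure 𝒜 a ≤ 1) :
    ∑ r ∈ Finset.range W,
      M.law 𝒜 ν (G ∩ {ω | (ucbPolicy M v W tie).act (k * W + 1 + r) ω = a}) ≤
      (u + W * ENNReal.ofReal (Real.exp (-(c * u))) + 1) * M.law 𝒜 ν G := by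
  set A := ucbPolicy M v W tie with hA
  set P := M.law 𝒜 ν with hP
  have hr : ∀ r ∈ Finset.range W, P (G ∩ {ω | A.act (k * W + 1 + r) ω = a}) ≤
      P (G ∩ {ω | A.act (k * W + 1 + r) ω = a ∧ pullCount A (k * W) r a ω < u}) +
      (ENNReal.ofReal (Real.exp (-(c * u))) * P G + ENNReal.ofReal (1 / W) * P G) := by
    intro r hr
    have hrW := Finset.mem_range.1 hr
    refine le_trans (measure_mono fun ω hω => ?_) ((measure_union_le _ _).trans
      (add_le_add le_rfl ((measure_union_le _ _).trans (add_le_add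
        (measure_overestimate_le M 𝒜 A (n := r) (u := u) hν hG hc hθ h1)
        (measure_underestimate_le M 𝒜 A hv hν hrW.le hW hG hb hsub)))))
    by_cases h : pullCount A (k * W) r a ω < u
    · exact Or.inl ⟨hω.1, hω.2, h⟩
    · rcases overestimate_or_underestimate M v W tie htie hrW hu hδ hδu (I := M.kl b) b hω.2
        (not_lt.1 h) with h' | h'
      · exact Or.inr (Or.inl ⟨hω.1, not_lt.1 h, h'⟩)
      · exact Or.inr (Or.inr ⟨hω.1, h'⟩)
  have hWW : (W : ℝ≥0∞) * ENNReal.ofReal (1 / W) = 1 := by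
    have : (W : ℝ) ≠ 0 := by exact_mod_cast (show W ≠ 0 by omega)
    rw [← ENNReal.ofReal_natCast, ← ENNReal.ofReal_mul W.cast_nonneg, mul_one_div_cancel this,
      ENNReal.ofReal_one]
  refine (Finset.sum_le_sum hr).trans ?_
  rw [Finset.sum_add_distrib, Finset.sum_const, Finset.card_range, nsmul_eq_mul]
  calc _ ≤ u * P G + W * (ENNReal.ofReal (Real.exp (-(c * u))) * P G +
        ENNReal.ofReal (1 / W) * P G) := by
        gcongr
        exact sum_measure_undersampled_le A P G (k * W) W u a
    _ = (u + W * ENNReal.ofReal (Real.exp (-(c * u))) + W * ENNReal.ofReal (1 / W)) * P G := by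
        ring
    _ = _ := by rw [hWW]

lemma eventually_log_le_mul {C ε : ℝ} (hε : 0 < ε) :
    ∀ᶠ W : ℕ in atTop, C * Real.log W ≤ ε * W := by
  have h := (Real.isLittleO_log_id_atTop.const_mul_left C).comp_tendsto
    tendsto_natCast_atTop_atTop
  filter_upwards [h.bound hε] with W hW
  simpa using (le_abs_self _).trans hW

/-- The UCB rule selects a stream with a negligible frequency if its log-likelihood ratios
concentrate below the divergence of an affected stream. -/
lemma eventually_sum_real_act_le (htie : ∀ s : Finset (Fin K), s.Nonempty → tie s ∈ s)
    (hv : 0 < v) {a b : Fin K} (hb : b ∈ 𝒜)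
    (hsub : HasSubgaussianMGF (fun x => M.llr b x - M.kl b) v (M.postMeasure b))
    {δ c θ : ℝ} (hδ : 0 < δ) (hc : 0 < c) (hθ : 0 < θ)
    (h1 : ∫⁻ y, ENNReal.ofReal (Real.exp (θ * (M.llr a y - (M.kl b - δ)) + c))
      ∂M.changedMeasure 𝒜 a ≤ 1) {ε : ℝ} (hε : 0 < ε) :
    ∀ᶠ W : ℕ in atTop, ∀ (k ν : ℕ) (G : Set (Observations K 𝓧)), ν ≤ k * W + 1 →
      MeasurableSet[history (ucbPolicy M v W tie).act (k * W)] G →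
      ∑ r ∈ Finset.range W,
        (M.law 𝒜 ν).real (G ∩ {ω | (ucbPolicy M v W tie).act (k * W + 1 + r) ω = a}) ≤
        ε * W * (M.law 𝒜 ν).real G := by
  have hcast : Tendsto (fun W : ℕ => (W : ℝ)) atTop atTop := tendsto_natCast_atTop_atTop
  have hexp : ∀ᶠ W : ℕ in atTop, Real.exp (-(c * (ε / 4 * W))) ≤ ε / 4 := by
    have : Tendsto (fun W : ℕ => Real.exp (-(c * (ε / 4 * W)))) atTop (𝓝 0) :=
      Real.tendsto_exp_neg_atTop_nhds_zero.comp
        ((hcast.const_mul_atTop (by positivity : 0 < ε / 4)).const_mul_atTop hc)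
    exact this.eventually_le_const (by positivity)
  have hlog := eventually_log_le_mul (C := 4 * v) (show 0 < δ ^ 2 * (ε / 4) by positivity)
  filter_upwards [hexp, hlog, eventually_ge_atTop 1, hcast.eventually_ge_atTop (4 / ε)] with
    W hexp hlog hW hW2 k ν G hν hG
  have hWpos : (0 : ℝ) < W := by exact_mod_cast hW
  -- A sample size linear in `W` suffices because only a frequency bound is wanted: `log W = o(W)`
  -- shrinks the radius below `δ`. Four terms of size `ε W / 4` result, one of them from rounding
  -- up.
  set u := ⌈ε / 4 * W⌉₊ with hu
  have hu1 : ε / 4 * W ≤ u := Nat.le_ceil _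
  have hu2 : (u : ℝ) ≤ ε / 4 * W + 1 := (Nat.ceil_lt_add_one (by positivity)).le
  have hW4 : 1 ≤ ε / 4 * W := by
    have := (div_le_iff₀ hε).1 hW2
    linarith
  have hmain := sum_measure_act_le M 𝒜 v tie htie hv hW hν hG hb hsub hδ.le hc.le hθ.le
    (Nat.ceil_pos.2 (by positivity)) (u := u)
    (hlog.trans (by rw [mul_assoc]; exact mul_le_mul_of_nonneg_left hu1 (sq_nonneg δ))) h1
  have hreal := ENNReal.toReal_mono (by finiteness) hmain
  rw [ENNReal.toReal_sum fun _ _ => measure_ne_top _ _, ENNReal.toReal_mul] at hreal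
  refine hreal.trans (mul_le_mul_of_nonneg_right ?_ measureReal_nonneg)
  rw [ENNReal.toReal_add (by finiteness) (by finiteness),
    ENNReal.toReal_add (by finiteness) (by finiteness), ENNReal.toReal_mul,
    ENNReal.toReal_ofReal (Real.exp_nonneg _), ENNReal.toReal_natCast, ENNReal.toReal_natCast,
    ENNReal.toReal_one]
  have h3 : Real.exp (-(c * u)) ≤ ε / 4 := le_trans (Real.exp_le_exp.2 (by
    have := mul_le_mul_of_nonneg_left hu1 hc.le
    linarith)) hexp
  nlinarith [mul_le_mul_of_nonneg_left h3 hWpos.le]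

/-- The capped log-likelihood ratio of the observation at time-step `i`. -/
def cappedStep (A : ControlPolicy K 𝓧) (B : ℝ) (i : ℕ) (ω : Observations K 𝓧) : ℝ :=
  min (M.llr (A.act i ω) (ω (i, A.act i ω))) B

lemma measurable_cappedStep (A : ControlPolicy K 𝓧) (B : ℝ) {i n : ℕ} (hi : 1 ≤ i) (hn : i ≤ n) :
    Measurable[history A.act n] (cappedStep M A B i) :=
  measurable_select_obs A hi hn (f := fun a x => min (M.llr a x) B)
    fun a => (M.measurable_llr a).min measurable_const

lemma integrable_cappedStep {v : ℝ≥0} (A : ControlPolicy K 𝓧)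
    (hsupp : ∀ a, ∀ᵐ x ∂M.base, M.pre a x = 0 ↔ M.post a x = 0)
    (hsub : ∀ a, HasSubgaussianMGF (fun x => M.llr a x - M.kl a) v (M.postMeasure a))
    (B : ℝ) {ν i : ℕ} (hi : 1 ≤ i) (hν : ν ≤ i) :
    Integrable (cappedStep M A B i) (M.law 𝒜 ν) := by
  have hint : ∀ a, Integrable (fun ω : Observations K 𝓧 => |min (M.llr a (ω (i, a))) B|)
      (M.law 𝒜 ν) := by
    intro a
    have h := M.integrable_min_llr (M.integrable_llr_changed 𝒜 (hsupp a) (hsub a)) B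
    rw [← M.obsLaw_of_le 𝒜 hν a] at h
    exact ((measurePreserving_eval_infinitePi (M.obsLaw 𝒜 ν) (i, a)).integrable_comp_of_integrable
      h).abs
  refine (integrable_finsetSum Finset.univ fun a _ => hint a).mono'
    ((measurable_cappedStep M A B hi le_rfl).mono (history_le A i) le_rfl).aestronglyMeasurable
    (.of_forall fun ω => ?_)
  exact Finset.single_le_sum (f := fun a => |min (M.llr a (ω (i, a))) B|)
    (fun a _ => abs_nonneg _) (Finset.mem_univ (A.act i ω))

/-- The conditional drift of the capped statistic over one interval of the UCB rule is
close to that of the best affected stream. -/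
lemma exists_eventually_drift_ge
    (hsupp : ∀ a, ∀ᵐ x ∂M.base, M.pre a x = 0 ↔ M.post a x = 0) (hkl : ∀ a, 0 < M.kl a)
    (hsub : ∀ a, HasSubgaussianMGF (fun x => M.llr a x - M.kl a) v (M.postMeasure a))
    (htie : ∀ s : Finset (Fin K), s.Nonempty → tie s ∈ s) (h𝒜 : 𝒜.Nonempty)
    {m : ℝ} (hm : m < M.maxKl 𝒜 h𝒜) :
    ∃ B : ℝ, 0 ≤ B ∧ ∀ᶠ W : ℕ in atTop, ∀ (k ν : ℕ) (G : Set (Observations K 𝓧)),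
      ν ≤ k * W + 1 → MeasurableSet[history (ucbPolicy M v W tie).act (k * W)] G →
      W * m * (M.law 𝒜 ν).real G ≤
        ∑ r ∈ Finset.range W,
          ∫ ω in G, cappedStep M (ucbPolicy M v W tie) B (k * W + 1 + r) ω ∂M.law 𝒜 ν := by
  obtain ⟨b, hb, hbI⟩ := Finset.exists_mem_eq_sup' h𝒜 M.kl
  change M.maxKl 𝒜 h𝒜 = M.kl b at hbI
  set I := M.maxKl 𝒜 h𝒜 with hI
  have hIpos : 0 < I := hbI ▸ hkl b
  have hv : 0 < v := by
    have h1 := M.kl_le (hsupp b) (hsub b)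
    have h2 := hkl b
    have : (0 : ℝ) < v := by linarith
    exact_mod_cast this
  -- Half of the slack `I - m` pays for the cap, the other half for inferior selections.
  set ε := (I - m) / 2 with hεdef
  have hε : 0 < ε := by rw [hεdef]; linarith
  obtain ⟨B, hB0, hB⟩ := M.exists_integral_min_llr_ge hsub hε
  refine ⟨B, hB0, ?_⟩
  set d : Fin K → ℝ := fun a => ∫ x, min (M.llr a x) B ∂M.changedMeasure 𝒜 a with hd
  set C := ∑ a, |d a - (I - ε)| with hC
  have hC0 : 0 ≤ C := Finset.sum_nonneg fun _ _ => abs_nonneg _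
  -- An inferior stream may have very negative drift, but it is finite; its frequency is chosen
  -- small relative to the total deviation `C`. The added `1` covers `C = 0`.
  set ε' := ε / (C + 1) with hε'def
  have hε' : 0 < ε' := by positivity
  have hCε : C * ε' ≤ ε := by
    rw [hε'def, mul_div_assoc', div_le_iff₀ (by linarith)]
    nlinarith
  have harm : ∀ a, ∀ᶠ W : ℕ in atTop, ∀ (k ν : ℕ) (G : Set (Observations K 𝓧)),
      ν ≤ k * W + 1 → MeasurableSet[history (ucbPolicy M v W tie).act (k * W)] G →
      -(|d a - (I - ε)| * (ε' * W * (M.law 𝒜 ν).real G)) ≤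
      (∑ r ∈ Finset.range W,
        (M.law 𝒜 ν).real (G ∩ {ω | (ucbPolicy M v W tie).act (k * W + 1 + r) ω = a})) *
          (d a - (I - ε)) := by
    intro a
    -- Otherwise `a` is an optimal affected stream, and selecting it can only help.
    by_cases ha : a ∈ 𝒜 → M.kl a < I
    · obtain ⟨δ, c, θ, hδ, hc, hθ, h1⟩ :=
        M.exists_exp_llr_le 𝒜 hIpos (hsupp a) (hkl a) (hsub a) ha
      rw [hbI] at h1
      filter_upwards [eventually_sum_real_act_le M 𝒜 v tie htie hv hb (hsub b) hδ hc hθ h1 hε']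
        with W hW k ν G hν hG
      have h := hW k ν G hν hG
      set S := ∑ r ∈ Finset.range W,
        (M.law 𝒜 ν).real (G ∩ {ω | (ucbPolicy M v W tie).act (k * W + 1 + r) ω = a}) with hS
      have hS0 : 0 ≤ S := Finset.sum_nonneg fun _ _ => measureReal_nonneg
      have h2 := mul_le_mul_of_nonneg_left h (abs_nonneg (d a - (I - ε)))
      have h3 := mul_le_mul_of_nonneg_left (neg_abs_le (d a - (I - ε))) hS0
      linarith
    · push Not at ha
      refine .of_forall fun W k ν G _ _ => ?_
      have hda : 0 ≤ d a - (I - ε) := by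
        have := hB a
        simp only [hd, Channels.changedMeasure, ha.1, if_true]
        linarith [ha.2]
      have h1 : 0 ≤ |d a - (I - ε)| * (ε' * W * (M.law 𝒜 ν).real G) := by positivity
      have h2 : 0 ≤ (∑ r ∈ Finset.range W,
        (M.law 𝒜 ν).real (G ∩ {ω | (ucbPolicy M v W tie).act (k * W + 1 + r) ω = a})) *
          (d a - (I - ε)) := mul_nonneg (Finset.sum_nonneg fun _ _ => measureReal_nonneg) hda
      linarith
  filter_upwards [eventually_all.2 harm] with W hW k ν G hν hG
  set A := ucbPolicy M v W tie with hA
  set P := M.law 𝒜 ν with hP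
  have hint : ∀ r, ∫ ω in G, cappedStep M A B (k * W + 1 + r) ω ∂P =
      ∑ a, P.real (G ∩ {ω | A.act (k * W + 1 + r) ω = a}) * d a := by
    intro r
    have hobs : ∀ a, M.obsLaw 𝒜 ν (k * W + r + 1, a) = M.changedMeasure 𝒜 a := fun a =>
      M.obsLaw_of_le 𝒜 (by omega) a
    have := setIntegral_select (M.obsLaw 𝒜 ν) A (k * W + r)
      (history_mono A.act (by omega) _ hG) (f := fun a x => min (M.llr a x) B)
      (fun a => (M.measurable_llr a).min measurable_const)
      (fun a => by
        rw [hobs a]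
        exact M.integrable_min_llr (M.integrable_llr_changed 𝒜 (hsupp a) (hsub a)) B)
    simp only [hobs] at this
    rw [show k * W + 1 + r = k * W + r + 1 by omega]
    exact this
  have hpart : ∀ r, ∑ a, P.real (G ∩ {ω | A.act (k * W + 1 + r) ω = a}) = P.real G := by
    intro r
    have := setIntegral_select (M.obsLaw 𝒜 ν) A (k * W + r)
      (history_mono A.act (by omega) _ hG) (f := fun _ _ => (1 : ℝ))
      (fun a => measurable_const) (fun a => integrable_const _)
    rw [show k * W + 1 + r = k * W + r + 1 by omega, hP, M.law_eq_infinitePi]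
    simpa using this.symm
  calc W * m * P.real G = W * (I - ε) * P.real G - ε * (W * P.real G) := by
        rw [hεdef]; ring
    _ ≤ W * (I - ε) * P.real G - C * ε' * (W * P.real G) := by
        gcongr
    _ = W * (I - ε) * P.real G + ∑ a, -(|d a - (I - ε)| * (ε' * W * P.real G)) := by
        rw [Finset.sum_neg_distrib, ← Finset.sum_mul, ← hC]; ring
    _ ≤ W * (I - ε) * P.real G + ∑ a, (∑ r ∈ Finset.range W,
          P.real (G ∩ {ω | A.act (k * W + 1 + r) ω = a})) * (d a - (I - ε)) := by
        gcongr with a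
        exact hW a k ν G hν hG
    _ = W * (I - ε) * P.real G + ∑ r ∈ Finset.range W, ∑ a,
          P.real (G ∩ {ω | A.act (k * W + 1 + r) ω = a}) * (d a - (I - ε)) := by
        simp only [Finset.sum_mul]
        rw [Finset.sum_comm]
    _ = _ := by
        simp only [hint, mul_sub, Finset.sum_sub_distrib, ← Finset.sum_mul, hpart,
          Finset.sum_const, Finset.card_range, nsmul_eq_mul]
        ring

end Drift

/-! ### Wald's bound -/

section Wald

variable {Ω : Type*}

/-- The partial sums of `Y` have stayed below `b` up to and including the `n`-th one. -/
def staysBelow (Y : ℕ → Ω → ℝ) (b : ℝ) (n : ℕ) : Set Ω :=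
  {ω | ∀ j ≤ n, ∑ i ∈ Finset.range j, Y i ω < b}

/-- The sum is frozen once the level has been reached: it was below `b` before the crossing step,
and that step adds at most `β`. -/
lemma sum_indicator_staysBelow_le {Y : ℕ → Ω → ℝ} {b β : ℝ} (hb : 0 ≤ b) (hβ : 0 ≤ β)
    {ω : Ω} (hY : ∀ j, Y j ω ≤ β) (N : ℕ) :
    ∑ k ∈ Finset.range N, (staysBelow Y b k).indicator (Y k) ω ≤ b + β := by
  suffices h : ∑ k ∈ Finset.range N, (staysBelow Y b k).indicator (Y k) ω ≤ b + β ∧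
      (ω ∈ staysBelow Y b N → ∑ k ∈ Finset.range N, (staysBelow Y b k).indicator (Y k) ω =
        ∑ k ∈ Finset.range N, Y k ω) from h.1
  induction N with
  | zero => simp; positivity
  | succ N ih =>
    rw [Finset.sum_range_succ, Finset.sum_range_succ]
    constructor
    · by_cases h : ω ∈ staysBelow Y b N
      · rw [Set.indicator_of_mem h, ih.2 h]
        exact add_le_add (h N le_rfl).le (hY N)
      · rw [Set.indicator_of_notMem h, add_zero]
        exact ih.1
    · intro h
      have h' : ω ∈ staysBelow Y b N := fun j hj => h j (hj.trans (Nat.le_succ N))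
      rw [Set.indicator_of_mem h', ih.2 h']

/-- Wald's bound for the number of steps needed to reach the level `b` by steps of conditional
drift at least `μ` and size at most `β`. -/
lemma mul_sum_staysBelow_le [MeasurableSpace Ω] {P : Measure Ω} [IsFiniteMeasure P] {Y : ℕ → Ω → ℝ} {b β μ : ℝ}
    (hb : 0 ≤ b) (hβ : 0 ≤ β) (hYβ : ∀ j ω, Y j ω ≤ β) (hY : ∀ j, Integrable (Y j) P)
    {G : Set Ω} (hD : ∀ k, MeasurableSet (staysBelow Y b k))
    (hdrift : ∀ k, μ * P.real (G ∩ staysBelow Y b k) ≤ ∫ ω in G ∩ staysBelow Y b k, Y k ω ∂P)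
    (N : ℕ) :
    μ * ∑ k ∈ Finset.range N, P.real (G ∩ staysBelow Y b k) ≤ (b + β) * P.real G := by
  rw [Finset.mul_sum]
  have hint : ∀ k, Integrable ((staysBelow Y b k).indicator (Y k)) (P.restrict G) := fun k =>
    ((hY k).indicator (hD k)).integrableOn
  calc _ ≤ ∑ k ∈ Finset.range N, ∫ ω in G ∩ staysBelow Y b k, Y k ω ∂P :=
        Finset.sum_le_sum fun k _ => hdrift k
    _ = ∫ ω in G, ∑ k ∈ Finset.range N, (staysBelow Y b k).indicator (Y k) ω ∂P := by
        rw [integral_finsetSum _ fun k _ => hint k]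
        refine Finset.sum_congr rfl fun k _ => ?_
        rw [setIntegral_indicator (hD k)]
    _ ≤ ∫ _ in G, (b + β) ∂P :=
        integral_mono (integrable_finsetSum _ fun k _ => hint k) (integrable_const _)
          fun ω => sum_indicator_staysBelow_le hb hβ (fun j => hYβ j ω) N
    _ = (b + β) * P.real G := by
        rw [setIntegral_const, smul_eq_mul, mul_comm]

end Wald

/-! ### From drift to worst-case delay -/

section Delay

/-- This replaces the worst conditional expectation by ordinary integrals over history events, the
form in which the drift bounds are uniform. -/
lemma essSup_condLExp_le {Ω : Type*} {m mΩ : MeasurableSpace Ω} {P : Measure Ω}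
    [IsFiniteMeasure P] (hm : m ≤ mΩ) {X : Ω → ℝ≥0∞} {c : ℝ≥0∞}
    (h : ∀ G, MeasurableSet[m] G → ∫⁻ ω in G, X ω ∂P ≤ c * P G) :
    essSup (condLExp m P X) P ≤ c := by
  refine essSup_le_of_ae_le c (ae_le_of_ae_le_trim (hm := hm) ?_)
  refine ae_le_of_forall_setLIntegral_le_of_sigmaFinite (measurable_condLExp m P X)
    fun s hs _ => ?_
  rw [setLIntegral_condLExp_trim hm P X hs, setLIntegral_const, trim_measurableSet_eq hm hs]
  exact h s hs

variable (M : Channels K 𝓧) (𝒜 : Finset (Fin K)) (A : ControlPolicy K 𝓧)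

/-- The sum of the capped log-likelihood ratios over the interval number `k`. -/
def blockSum (B : ℝ) (W k : ℕ) (ω : Observations K 𝓧) : ℝ :=
  ∑ r ∈ Finset.range W, cappedStep M A B (k * W + 1 + r) ω

/-- Neither the reset at zero nor removing the cap can lower the statistic, whatever its value at
time `s`. -/
lemma sum_cappedStep_le_cusum (B : ℝ) (s n : ℕ) (ω : Observations K 𝓧) :
    ∑ i ∈ Finset.range n, cappedStep M A B (s + 1 + i) ω ≤ max (cusum M A (s + n) ω) 0 := by
  induction n with
  | zero => simp
  | succ n ih =>
    rw [Finset.sum_range_succ, ← add_assoc, cusum]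
    refine le_trans (add_le_add ih ?_) (le_max_left _ _)
    rw [show s + 1 + n = s + n + 1 by omega]
    exact min_le_left _ _

lemma sum_blockSum (B : ℝ) (W k₀ k : ℕ) (ω : Observations K 𝓧) :
    ∑ j ∈ Finset.range k, blockSum M A B W (k₀ + j) ω =
      ∑ i ∈ Finset.range (k * W), cappedStep M A B (k₀ * W + 1 + i) ω := by
  induction k with
  | zero => simp
  | succ k ih =>
    rw [Finset.sum_range_succ, ih, Nat.succ_mul, Finset.sum_range_add]
    congr 1
    refine Finset.sum_congr rfl fun r _ => ?_
    congr 1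
    ring

lemma alarmTime_le_of_le_sum {B b : ℝ} (hb : 0 < b) {W k₀ k : ℕ} {ω : Observations K 𝓧}
    (h : b ≤ ∑ j ∈ Finset.range k, blockSum M A B W (k₀ + j) ω) :
    alarmTime M A b ω ≤ ((k₀ * W + k * W : ℕ) : ℕ∞) := by
  rw [sum_blockSum] at h
  have h1 : b ≤ cusum M A (k₀ * W + k * W) ω := by
    rcases le_max_iff.1 (h.trans (sum_cappedStep_le_cusum M A B (k₀ * W) (k * W) ω)) with h | h
    · exact h
    · linarith
  refine hittingAfter_le_of_mem (Nat.one_le_iff_ne_zero.2 fun h0 => ?_) h1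
  rw [h0, cusum] at h1
  linarith

/-- The indicator series counts the intervals completed before the sums cross `b`; the extra `W`
covers the wait until interval `k₀` begins. -/
lemma delay_le {B b : ℝ} (hb : 0 < b) {W k₀ ν : ℕ} (hW : 1 ≤ W) (hk : k₀ * W + 1 ≤ ν + W)
    (ω : Observations K 𝓧) :
    (alarmTime M A b ω : ℝ≥0∞) + 1 - (ν : ℝ≥0∞) ≤
      W + W * ∑' k, (staysBelow (fun j => blockSum M A B W (k₀ + j)) b k).indicator 1 ω := by
  classical
  set D := staysBelow (fun j => blockSum M A B W (k₀ + j)) b with hD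
  by_cases hex : ∃ k, b ≤ ∑ j ∈ Finset.range k, blockSum M A B W (k₀ + j) ω
  · set k := Nat.find hex
    have hT := alarmTime_le_of_le_sum M A hb (Nat.find_spec hex)
    have hsum : (k : ℝ≥0∞) ≤ ∑' k, (D k).indicator 1 ω := by
      refine le_trans (le_of_eq ?_) (ENNReal.sum_le_tsum (Finset.range k))
      rw [Finset.sum_congr rfl fun i hi => Set.indicator_of_mem (s := D i) (a := ω) (f := 1) ?_]
      · simp
      · intro j hj
        exact not_le.1 (Nat.find_min hex (hj.trans_lt (Finset.mem_range.1 hi)))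
    have hT' : (alarmTime M A b ω : ℝ≥0∞) ≤ ((k₀ * W + k * W : ℕ) : ℝ≥0∞) := by
      have := ENat.toENNReal_le.2 hT
      simpa using this
    rw [tsub_le_iff_right]
    calc (alarmTime M A b ω : ℝ≥0∞) + 1 ≤ ((k₀ * W + k * W : ℕ) : ℝ≥0∞) + 1 := by gcongr
      _ = ((k₀ * W + 1 + k * W : ℕ) : ℝ≥0∞) := by push_cast; ring
      _ ≤ ((ν + W + k * W : ℕ) : ℝ≥0∞) := by exact_mod_cast Nat.add_le_add_right hk _
      _ = W + W * (k : ℝ≥0∞) + ν := by push_cast; ring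
      _ ≤ _ := by gcongr
  -- If the level is never reached, the series is infinite and the bound is trivial.
  · push Not at hex
    have h1 : ∀ k, (D k).indicator (1 : Observations K 𝓧 → ℝ≥0∞) ω = 1 := fun k =>
      Set.indicator_of_mem (show ω ∈ D k from fun j _ => hex j) _
    have hW0 : (W : ℝ≥0∞) ≠ 0 := by exact_mod_cast (show W ≠ 0 by omega)
    simp [h1, hW0]

lemma measurable_blockSum {B : ℝ} {W k n : ℕ} (h : k * W + W ≤ n) :
    Measurable[history A.act n] (blockSum M A B W k) :=
  Finset.measurable_fun_sum _ fun r hr =>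
    measurable_cappedStep M A B (by omega) (by have := Finset.mem_range.1 hr; omega)

lemma measurableSet_staysBelow (B b : ℝ) (W k₀ k : ℕ) :
    MeasurableSet[history A.act ((k₀ + k) * W)]
      (staysBelow (fun j => blockSum M A B W (k₀ + j)) b k) := by
  have : staysBelow (fun j => blockSum M A B W (k₀ + j)) b k =
      ⋂ j ∈ Finset.range (k + 1),
        {ω | ∑ i ∈ Finset.range j, blockSum M A B W (k₀ + i) ω < b} := by
    ext ω; simp [staysBelow]
  rw [this]
  refine Finset.measurableSet_biInter _ fun j hj => measurableSet_lt ?_ measurable_const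
  refine Finset.measurable_fun_sum _ fun i hi => measurable_blockSum M A ?_
  have h1 := Finset.mem_range.1 hj
  have h2 := Finset.mem_range.1 hi
  calc (k₀ + i) * W + W = (k₀ + i + 1) * W := by ring
    _ ≤ (k₀ + k) * W := Nat.mul_le_mul_right _ (by omega)

/-- If the capped statistic has a drift of at least `m` per time-step over every interval, then
the worst-case delay is at most `b / m` up to a multiple of the interval length. -/
lemma worstCaseDelay_le {v : ℝ≥0}
    (hsupp : ∀ a, ∀ᵐ x ∂M.base, M.pre a x = 0 ↔ M.post a x = 0)
    (hsub : ∀ a, HasSubgaussianMGF (fun x => M.llr a x - M.kl a) v (M.postMeasure a))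
    {B b m : ℝ} (hB : 0 ≤ B) (hb : 0 < b) (hm : 0 < m) {W : ℕ} (hW : 1 ≤ W)
    (hdrift : ∀ (k ν : ℕ) (G : Set (Observations K 𝓧)), ν ≤ k * W + 1 →
      MeasurableSet[history A.act (k * W)] G →
      W * m * (M.law 𝒜 ν).real G ≤
        ∑ r ∈ Finset.range W, ∫ ω in G, cappedStep M A B (k * W + 1 + r) ω ∂M.law 𝒜 ν) :
    worstCaseDelay M 𝒜 A (alarmTime M A b) ≤ ENNReal.ofReal (W + (b + W * B) / m) := by
  have hWpos : (0 : ℝ) < W := by exact_mod_cast hW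
  refine iSup₂_le fun ν hν => essSup_condLExp_le (history_le A _) fun G hG => ?_
  set P := M.law 𝒜 ν with hP
  -- This is `(ν - 1) / W` rounded up, the index of the first interval lying entirely after the
  -- change.
  set k₀ := (ν - 1 + (W - 1)) / W with hk₀
  have hk1 : ν ≤ k₀ * W + 1 := by
    have h1 := Nat.lt_div_mul_add (a := ν - 1 + (W - 1)) (show 0 < W by omega)
    rw [← hk₀] at h1
    omega
  have hk2 : k₀ * W + 1 ≤ ν + W := by
    have h1 := Nat.div_mul_le_self (ν - 1 + (W - 1)) W
    rw [← hk₀] at h1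
    omega
  set Y : ℕ → Observations K 𝓧 → ℝ := fun j => blockSum M A B W (k₀ + j) with hY
  have hle : ∀ j, k₀ * W ≤ (k₀ + j) * W := fun j => Nat.mul_le_mul_right _ (by omega)
  have hD : ∀ k, MeasurableSet (staysBelow Y b k) := fun k =>
    history_le A _ _ (measurableSet_staysBelow M A B b W k₀ k)
  have hstep : ∀ j r, Integrable (cappedStep M A B ((k₀ + j) * W + 1 + r)) P := fun j r =>
    integrable_cappedStep M 𝒜 A hsupp hsub B (by omega) (by have := hle j; omega)
  have hwald := mul_sum_staysBelow_le (P := P) (Y := Y) (b := b) (β := W * B) (μ := W * m)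
    (G := G) hb.le (by positivity)
    (fun j ω => by
      refine (Finset.sum_le_card_nsmul _ _ B fun r _ => min_le_right _ _).trans (le_of_eq ?_)
      simp)
    (fun j => integrable_finsetSum _ fun r _ => hstep j r) hD
    -- Whether the sums have stayed below `b` through `k` intervals is known when interval `k₀ + k`
    -- begins, so the drift bound applies on that event.
    (fun k => by
      refine (hdrift (k₀ + k) ν (G ∩ staysBelow Y b k) (by have := hle k; omega) ?_).trans
        (le_of_eq ?_)
      · refine MeasurableSet.inter (history_mono A.act ?_ _ hG)
          (measurableSet_staysBelow M A B b W k₀ k)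
        have := hle k
        omega
      · exact (integral_finsetSum _ fun r _ => (hstep k r).integrableOn).symm)
  have hcount : ∑' k, P (G ∩ staysBelow Y b k) ≤
      ENNReal.ofReal ((b + W * B) / (W * m)) * P G := by
    rw [ENNReal.tsum_eq_iSup_nat]
    refine iSup_le fun N => ?_
    rw [← ENNReal.ofReal_toReal (measure_ne_top P G), ← ENNReal.ofReal_mul (by positivity)]
    refine (ENNReal.le_ofReal_iff_toReal_le
      (ENNReal.sum_ne_top.2 fun _ _ => measure_ne_top _ _) (by positivity)).2 ?_
    rw [ENNReal.toReal_sum fun _ _ => measure_ne_top _ _, div_mul_eq_mul_div,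
      le_div_iff₀ (by positivity), mul_comm]
    exact hwald N
  calc ∫⁻ ω in G, (alarmTime M A b ω : ℝ≥0∞) + 1 - (ν : ℝ≥0∞) ∂P
      ≤ ∫⁻ ω in G, W + W * ∑' k, (staysBelow Y b k).indicator 1 ω ∂P :=
        lintegral_mono fun ω => delay_le M A hb hW hk2 ω
    _ = W * P G + W * ∑' k, P (G ∩ staysBelow Y b k) := by
        rw [lintegral_add_left measurable_const, setLIntegral_const, lintegral_const_mul _
          (Measurable.tsum fun k => measurable_one.indicator (hD k)),
          lintegral_tsum fun k => (measurable_one.indicator (hD k)).aemeasurable]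
        congr 3
        ext k
        rw [lintegral_indicator_one (hD k), Measure.restrict_apply (hD k), Set.inter_comm]
    _ ≤ W * P G + W * (ENNReal.ofReal ((b + W * B) / (W * m)) * P G) := by gcongr
    _ = ENNReal.ofReal (W + (b + W * B) / m) * P G := by
        rw [← mul_assoc, ← add_mul, ← ENNReal.ofReal_natCast, ← ENNReal.ofReal_mul hWpos.le,
          ← ENNReal.ofReal_add hWpos.le (by positivity)]
        congr 3
        field_simp

end Delay

/-! ### Asymptotics -/

lemma eventually_worstCaseDelay_le (M : Channels K 𝓧)
    (hsupp : ∀ a, ∀ᵐ x ∂M.base, M.pre a x = 0 ↔ M.post a x = 0) (hkl : ∀ a, 0 < M.kl a)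
    (v : ℝ≥0)
    (hsub : ∀ a, HasSubgaussianMGF (fun x => M.llr a x - M.kl a) v (M.postMeasure a))
    (tie : Finset (Fin K) → Fin K) (htie : ∀ s : Finset (Fin K), s.Nonempty → tie s ∈ s)
    (𝒜 : Finset (Fin K)) (h𝒜 : 𝒜.Nonempty) {ι : Type*} (l : Filter ι) (b : ι → ℝ) (W : ι → ℕ)
    (hb : Tendsto b l atTop) (hW : Tendsto W l atTop)
    (hWb : (fun i => (W i : ℝ)) =o[l] b) {ε : ℝ} (hε : 0 < ε) :
    ∀ᶠ i in l, worstCaseDelay M 𝒜 (ucbPolicy M v (W i) tie)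
        (alarmTime M (ucbPolicy M v (W i) tie) (b i)) ≤
      ENNReal.ofReal (b i / M.maxKl 𝒜 h𝒜 * (1 + ε)) := by
  set I := M.maxKl 𝒜 h𝒜 with hI
  have hIpos : 0 < I := by
    obtain ⟨a, ha⟩ := h𝒜
    exact (hkl a).trans_le (Finset.le_sup' M.kl ha)
  -- This makes `b / m = (b / I)(1 + ε / 2)`. The cap `B` is then fixed, and `W = o(b)` makes the
  -- rest at most `(b / I)(ε / 2)`.
  set m := I / (1 + ε / 2) with hmdef
  have hm : 0 < m := by positivity
  have hmI : m < I := div_lt_self hIpos (by linarith)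
  obtain ⟨B, hB, hdrift⟩ := exists_eventually_drift_ge M 𝒜 v tie hsupp hkl hsub htie h𝒜 hmI
  have hη : 0 < ε / (2 * I * (1 + B / m)) := by positivity
  filter_upwards [hW.eventually hdrift, hW.eventually_ge_atTop 1, hb.eventually_gt_atTop 0,
    hWb.bound hη] with i hdrift hW1 hb0 hWi
  refine (worstCaseDelay_le M 𝒜 (ucbPolicy M v (W i) tie) hsupp hsub hB hb0 hm hW1 hdrift).trans
    (ENNReal.ofReal_le_ofReal ?_)
  rw [Real.norm_of_nonneg (Nat.cast_nonneg _), Real.norm_of_nonneg hb0.le] at hWi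
  have hBm : 0 < 1 + B / m := by positivity
  calc (W i : ℝ) + (b i + W i * B) / m = b i / m + W i * (1 + B / m) := by ring
    _ ≤ b i / m + ε / (2 * I * (1 + B / m)) * b i * (1 + B / m) := by gcongr
    _ = b i / I * (1 + ε) := by
      have h1 : b i / m = b i / I * (1 + ε / 2) := by rw [hmdef]; field_simp
      have h2 : ε / (2 * I * (1 + B / m)) * b i * (1 + B / m) = b i / I * (ε / 2) := by
        generalize 1 + B / m = c at hBm
        field_simp
      rw [h1, h2]; ring

/-- An eventual bound by `x (1 + ε)` for every `ε > 0` is a bound by `x (1 + o(1))`. -/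
lemma exists_tendsto_zero_le_ofReal {ι : Type*} {l : Filter ι} {d : ι → ℝ≥0∞} {x : ι → ℝ}
    (hx : ∀ᶠ i in l, 0 < x i)
    (h : ∀ ε : ℝ, 0 < ε → ∀ᶠ i in l, d i ≤ ENNReal.ofReal (x i * (1 + ε))) :
    ∃ r : ι → ℝ, Tendsto r l (𝓝 0) ∧ ∀ᶠ i in l, d i ≤ ENNReal.ofReal (x i * (1 + r i)) := by
  refine ⟨fun i => max 0 ((d i).toReal / x i - 1), ?_, ?_⟩
  · refine tendsto_order.2 ⟨fun c hc => .of_forall fun i => hc.trans_le (le_max_left _ _),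
      fun c hc => ?_⟩
    filter_upwards [hx, h (c / 2) (by positivity)] with i hxi hi
    refine max_lt hc ?_
    have h1 := ENNReal.toReal_le_of_le_ofReal (by positivity) hi
    have h2 : (d i).toReal / x i ≤ 1 + c / 2 := by
      rw [div_le_iff₀ hxi]; linarith
    linarith
  -- The case `ε = 1` shows that `d i` is eventually finite, so `toReal` loses nothing.
  · filter_upwards [hx, h 1 one_pos] with i hxi hi
    have hd : d i ≠ ∞ := ne_top_of_le_ne_top ENNReal.ofReal_ne_top hi
    refine le_trans (ENNReal.ofReal_toReal hd).ge (ENNReal.ofReal_le_ofReal ?_)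
    calc (d i).toReal = x i * (1 + ((d i).toReal / x i - 1)) := by field_simp; ring
      _ ≤ x i * (1 + max 0 ((d i).toReal / x i - 1)) := by
        gcongr
        exact le_max_right 0 ((d i).toReal / x i - 1)

end BanditQCD

end

theorem theorem1 {K : ℕ} {𝓧 : Type*} [MeasurableSpace 𝓧] (M : BanditQCD.Channels K 𝓧)
    (hsupp : ∀ a, ∀ᵐ x ∂M.base, M.pre a x = 0 ↔ M.post a x = 0)
    (hkl : ∀ a, 0 < M.kl a)
    (v : ℝ≥0)
    (hsub : ∀ a, HasSubgaussianMGF (fun x => M.llr a x - M.kl a) v (M.postMeasure a))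
    (tie : Finset (Fin K) → Fin K) (htie : ∀ s : Finset (Fin K), s.Nonempty → tie s ∈ s) :
    (∀ (γ : ℝ) (W : ℕ), 0 < γ → 0 < W →
      ENNReal.ofReal γ ≤ BanditQCD.meanTimeToFalseAlarm M
        (BanditQCD.alarmTime M (BanditQCD.ucbPolicy M v W tie) (Real.log γ))) ∧
    (∀ (𝒜 : Finset (Fin K)) (h𝒜 : 𝒜.Nonempty) {ι : Type*} (l : Filter ι) (γ : ι → ℝ) (W : ι → ℕ),
      Tendsto γ l atTop → Tendsto W l atTop →
      (fun i => (W i : ℝ)) =o[l] (fun i => Real.log (γ i)) →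
      ∃ r : ι → ℝ, Tendsto r l (𝓝 0) ∧
        ∀ᶠ i in l,
          BanditQCD.worstCaseDelay M 𝒜 (BanditQCD.ucbPolicy M v (W i) tie)
              (BanditQCD.alarmTime M (BanditQCD.ucbPolicy M v (W i) tie) (Real.log (γ i))) ≤
            ENNReal.ofReal (Real.log (γ i) / M.maxKl 𝒜 h𝒜 * (1 + r i))) := by
  refine ⟨fun γ W hγ _ => BanditQCD.ofReal_le_meanTimeToFalseAlarm M _ hsupp hγ, ?_⟩
  intro 𝒜 h𝒜 ι l γ W hγ hW hWγ
  have hlog : Tendsto (fun i => Real.log (γ i)) l atTop := Real.tendsto_log_atTop.comp hγ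
  have hI : 0 < M.maxKl 𝒜 h𝒜 := by
    obtain ⟨a, ha⟩ := h𝒜
    exact (hkl a).trans_le (Finset.le_sup' M.kl ha)
  refine BanditQCD.exists_tendsto_zero_le_ofReal ?_ fun ε hε =>
    BanditQCD.eventually_worstCaseDelay_le M hsupp hkl v hsub tie htie 𝒜 h𝒜 l _ W hlog hW hWγ hε
  filter_upwards [hlog.eventually_gt_atTop 0] with i hi
  exact div_pos hi hI
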